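/- Let $d\in\mathbb N$, let $J=\begin{pmatrix}0&\mathrm{Id}_d\\-\mathrm{Id}_d&0\end{pmatrix}$, let $\mathrm{Sp}(2d,\mathbb Z)$ be the group of integer $2d\times 2d$ matrices $B$ with $B^TJB=J$, and equip $\mathbb Q^{2d}$ with the symplectic form $\omega(v,w)=v^TJw$. Let $A\in\mathrm{Sp}(2d,\mathbb Z)$ have separable characteristic polynomial (that is, one without multiple roots in $\mathbb C$). Counting eigenvalues with multiplicity, the number of real eigenvalues of $A$ is even; write it as $2m(A)$. The number of eigenvalues of $A$ in $\mathbb C\setminus(\mathbb R\cup\mathbb S^1)$, where $\mathbb S^1=\{z\in\mathbb C:|z|=1\}$, is divisible by $4$; write it as $4l(A)$. Call an $A$-invariant subspace $W\subseteq\mathbb Q^{2d}$ irreducible if $W\neq 0$ and its only $A$-invariant subspaces are $0$ and $W$, and isotropic if $\omega$ vanishes on $W\times W$. The number of irreducible isotropic $A$-invariant subspaces of $\mathbb Q^{2d}$ is finite and even; write it as $2I(A)$. Then $I(A)\le m(A)+l(A)$, and the centralizer $\mathrm{Sp}(2d,\mathbb Z)_A=\{B\in\mathrm{Sp}(2d,\mathbb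 Z): AB=BA\}$ satisfies $$\mathrm{Sp}(2d,\mathbb Z)_A\;\cong\; F\times\mathbb Z^{\,m(A)+l(A)-I(A)},$$ where $F$ is a finite abelian subgroup of $\mathrm{Sp}(2d,\mathbb Z)_A$, so that it consists of matrices $B$ with $B^{|F|}=1$. -/

import Mathlib

open scoped Matrix

namespace SymplecticCentralizer

/-- The number of real eigenvalues of an integer matrix, counted with multiplicity. -/
noncomputable def numRealEigenvalues {ι : Type*} [Fintype ι] [DecidableEq ι]
    (A : Matrix ι ι ℤ) : ℕ :=
  open Classical in
  ((A.map (Int.cast : ℤ → ℂ)).charpoly.roots.filter (fun z : ℂ => z.im = 0)).card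

/-- The number of eigenvalues in `ℂ ∖ (ℝ ∪ 𝕊¹)` of an integer matrix, counted with
multiplicity. -/
noncomputable def numGenericEigenvalues {ι : Type*} [Fintype ι] [DecidableEq ι]
    (A : Matrix ι ι ℤ) : ℕ :=
  open Classical in
  ((A.map (Int.cast : ℤ → ℂ)).charpoly.roots.filter
    (fun z : ℂ => z.im ≠ 0 ∧ ‖z‖ ≠ 1)).card

/-- The subspace `W` of `ℚ^ι` is mapped into itself by `A`. -/
def IsInvariant {ι : Type*} [Fintype ι] (A : Matrix ι ι ℤ) (W : Submodule ℚ (ι → ℚ)) : Prop :=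
  ∀ v ∈ W, (A.map (Int.cast : ℤ → ℚ)) *ᵥ v ∈ W

/-- `W` is an irreducible `A`-invariant subspace: it is invariant and nonzero, and its only
invariant subspaces are `0` and `W`. -/
def IsIrreducibleInvariant {ι : Type*} [Fintype ι] (A : Matrix ι ι ℤ)
    (W : Submodule ℚ (ι → ℚ)) : Prop :=
  IsInvariant A W ∧ W ≠ ⊥ ∧
    ∀ U : Submodule ℚ (ι → ℚ), U ≤ W → IsInvariant A U → U = ⊥ ∨ U = W

/-- The standard symplectic form `ω(v, w) = vᵀ J w` of `ℚ^{2d}` vanishes on `W × W`, that is,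
`W` is contained in its symplectic orthogonal. -/
def IsIsotropic {d : ℕ} (W : Submodule ℚ (Fin d ⊕ Fin d → ℚ)) : Prop :=
  ∀ v ∈ W, ∀ w ∈ W, v ⬝ᵥ (Matrix.J (Fin d) ℚ *ᵥ w) = 0

/-- The set of irreducible isotropic `A`-invariant subspaces of `ℚ^{2d}`. -/
def irreducibleIsotropicSubspaces {d : ℕ} (A : Matrix (Fin d ⊕ Fin d) (Fin d ⊕ Fin d) ℤ) :
    Set (Submodule ℚ (Fin d ⊕ Fin d → ℚ)) :=
  {W | IsIrreducibleInvariant A W ∧ IsIsotropic W}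

end SymplecticCentralizer

/-!
# Centralizers in integral symplectic groups

Let `f` be the characteristic polynomial of `A`, separable over `ℚ`, and let `R` be the set of its
complex roots. A cyclic vector shows that every matrix commuting with `A` is a polynomial `g(A)`
(`exists_polynomial_of_commute`), and such a matrix is determined by its eigenvalues `g(z)`, `z ∈ R`
(`aeval_eq_iff`). The adjoint with respect to `ω` sends `A` to `A⁻¹`, hence `g(A)` to `g(A⁻¹)`, so
`R` is closed under `z ↦ z⁻¹`, and an integer matrix `g(A)` is symplectic exactly when
`g(z) g(z⁻¹) = 1` on `R`. The centralizer is thus the group of norm-one units, for the involution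
`A ↦ A⁻¹`, of the order `ℚ[A] ∩ M(ℤ)`.

The irreducible invariant subspaces are the `ker p(A)` for the irreducible factors `p` of `f`, and
`ker p(A)` is isotropic exactly when `p` differs from its dual, the factor whose roots are the
inverses of those of `p` (`irreducibleIsotropicSubspaces_eq_image`). As an eigenline is isotropic,
`±1 ∉ R` (`inv_ne_self_of_root`). Duality is an involution without fixed points on these factors,
so their number `2I` is even.

For the rank, map `g(A)` to the function `z ↦ log |g(z)|` on `R`. On the centralizer this function
is invariant under conjugation, changes sign under inversion, and sums to zero over the roots of
each irreducible factor; `unitLogSpace` is the space of all such functions. The image spans it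
(`span_range_logMap`): by Dirichlet's unit theorem for the fields `ℚ[X]/(p)`, and because units of
the maximal order have powers in `ℚ[A] ∩ M(ℤ)`, any `x` in the space is a combination of
logarithms of units `u` of this order, and then `x = (x - x ∘ inv) / 2` is a combination of the
logarithms of the `u` divided by their adjoints, which lie in the centralizer. Only finitely many
elements have bounded logarithm (`finite_logMap_le`), so the kernel is finite, the image is a
lattice, and the centralizer is the product of the kernel and a free abelian group of rank
`dim unitLogSpace` (`exists_mulEquiv_of_log`).

Finally `dim unitLogSpace = m + l - I` (`exists_finrank_unitLogSpace`). A function that is invariant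
under conjugation and changes sign under inversion is determined by arbitrary values at the roots
with `|z| > 1` and `Im z ≥ 0`, and there are `m` real and `l` nonreal ones among these. Its sum over
the roots of a self-dual factor vanishes automatically, and each pair of distinct dual factors
imposes one condition; these conditions are independent.
-/

namespace SymplecticCentralizer

open Polynomial

/-! ### Matrices with separable characteristic polynomial -/

section EtaleAlgebra

variable {ι : Type*} [Fintype ι] [DecidableEq ι]

lemma aeval_map_matrix (M : Matrix ι ι ℚ) (g : ℚ[X]) :
    aeval (M.map (algebraMap ℚ ℂ)) (g.map (algebraMap ℚ ℂ)) =
      (aeval M g).map (algebraMap ℚ ℂ) := by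
  rw [aeval_map_algebraMap]
  exact (aeval_algHom_apply (AlgHom.mapMatrix (Algebra.ofId ℚ ℂ)) M g)

lemma charpoly_map_dvd_of_roots {M : Matrix ι ι ℚ} (hM : M.charpoly.Separable) {h : ℂ[X]}
    (hh : ∀ z ∈ M.charpoly.rootSet ℂ, h.eval z = 0) :
    M.charpoly.map (algebraMap ℚ ℂ) ∣ h := by
  rcases eq_or_ne h 0 with rfl | h0
  · exact dvd_zero _
  have hmonic : (M.charpoly.map (algebraMap ℚ ℂ)).Monic := (M.charpoly_monic).map _
  rw [(IsAlgClosed.splits (M.charpoly.map (algebraMap ℚ ℂ))).eq_prod_roots_of_monic hmonic,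
    Multiset.prod_X_sub_C_dvd_iff_le_roots h0, Multiset.le_iff_subset (nodup_roots hM.map)]
  intro z hz
  rw [mem_roots h0]
  refine hh z ?_
  rw [mem_rootSet']
  exact ⟨hmonic.ne_zero, by simpa using (mem_roots'.1 hz).2⟩

/-- A complex polynomial that vanishes at all eigenvalues of a matrix without multiple
eigenvalues annihilates the matrix. -/
lemma aeval_map_eq_zero_of_roots {M : Matrix ι ι ℚ} (hM : M.charpoly.Separable) {h : ℂ[X]}
    (hh : ∀ z ∈ M.charpoly.rootSet ℂ, h.eval z = 0) :
    aeval (M.map (algebraMap ℚ ℂ)) h = 0 := by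
  obtain ⟨k, rfl⟩ := charpoly_map_dvd_of_roots hM hh
  have : M.charpoly.map (algebraMap ℚ ℂ) = (M.map (algebraMap ℚ ℂ)).charpoly :=
    (Matrix.charpoly_map _ _).symm
  rw [map_mul, this, Matrix.aeval_self_charpoly, zero_mul]

lemma aeval_eq_zero_of_roots {M : Matrix ι ι ℚ} (hM : M.charpoly.Separable) {g : ℚ[X]}
    (hg : ∀ z ∈ M.charpoly.rootSet ℂ, aeval z g = 0) : aeval M g = 0 := by
  have := aeval_map_eq_zero_of_roots hM (h := g.map (algebraMap ℚ ℂ)) (by simpa using hg)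
  rw [aeval_map_matrix] at this
  ext i j
  have := congrFun (congrFun this i) j
  simpa using this

lemma aeval_root_eq_zero {M : Matrix ι ι ℚ} {g : ℚ[X]} (hg : aeval M g = 0) {z : ℂ}
    (hz : z ∈ M.charpoly.rootSet ℂ) : aeval z g = 0 := by
  have h1 : z ∈ spectrum ℂ (M.map (algebraMap ℚ ℂ)) := by
    rw [Matrix.mem_spectrum_iff_isRoot_charpoly, Matrix.charpoly_map]
    simpa using (mem_rootSet'.1 hz).2
  have h2 := spectrum.subset_polynomial_aeval (M.map (algebraMap ℚ ℂ)) (g.map (algebraMap ℚ ℂ))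
    ⟨z, h1, rfl⟩
  rw [aeval_map_matrix, hg] at h2
  by_contra hne
  apply h2
  simp only [Matrix.map_zero, map_zero]
  rw [spectrum.mem_resolventSet_iff, sub_zero]
  refine (IsUnit.mk0 _ ?_).map (algebraMap ℂ (Matrix ι ι ℂ))
  simpa using hne

lemma aeval_eq_zero_iff {M : Matrix ι ι ℚ} (hM : M.charpoly.Separable) {g : ℚ[X]} :
    aeval M g = 0 ↔ ∀ z ∈ M.charpoly.rootSet ℂ, aeval z g = 0 :=
  ⟨fun h _ hz => aeval_root_eq_zero h hz, aeval_eq_zero_of_roots hM⟩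

lemma aeval_eq_iff {M : Matrix ι ι ℚ} (hM : M.charpoly.Separable) {g h : ℚ[X]} :
    aeval M g = aeval M h ↔ ∀ z ∈ M.charpoly.rootSet ℂ, aeval z g = aeval z h := by
  rw [← sub_eq_zero, ← map_sub, aeval_eq_zero_iff hM]
  simp [sub_eq_zero]

/-- The irreducible factors of the characteristic polynomial, as the set of minimal polynomials
of the eigenvalues. -/
noncomputable def factors (M : Matrix ι ι ℚ) : Finset ℚ[X] :=
  (M.charpoly.rootSet ℂ).toFinset.image (minpoly ℚ)

lemma mem_factors {M : Matrix ι ι ℚ} {p : ℚ[X]} :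
    p ∈ factors M ↔ ∃ z ∈ M.charpoly.rootSet ℂ, minpoly ℚ z = p := by
  simp [factors]

lemma isIntegral_of_mem_rootSet {M : Matrix ι ι ℚ} {z : ℂ} (hz : z ∈ M.charpoly.rootSet ℂ) :
    IsIntegral ℚ z :=
  ⟨M.charpoly, M.charpoly_monic, (mem_rootSet'.1 hz).2⟩

lemma irreducible_of_mem_factors {M : Matrix ι ι ℚ} {p : ℚ[X]} (hp : p ∈ factors M) :
    Irreducible p := by
  obtain ⟨z, hz, rfl⟩ := mem_factors.1 hp
  exact minpoly.irreducible (isIntegral_of_mem_rootSet hz)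

lemma monic_of_mem_factors {M : Matrix ι ι ℚ} {p : ℚ[X]} (hp : p ∈ factors M) :
    p.Monic := by
  obtain ⟨z, hz, rfl⟩ := mem_factors.1 hp
  exact minpoly.monic (isIntegral_of_mem_rootSet hz)

lemma minpoly_eq_iff {M : Matrix ι ι ℚ} {p : ℚ[X]} (hp : p ∈ factors M) {z : ℂ} :
    minpoly ℚ z = p ↔ aeval z p = 0 := by
  constructor
  · rintro rfl; exact minpoly.aeval _ _
  · intro h
    exact (minpoly.eq_of_irreducible_of_monic (irreducible_of_mem_factors hp) h
      (monic_of_mem_factors hp)).symm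

lemma dvd_charpoly_of_mem_factors {M : Matrix ι ι ℚ} {p : ℚ[X]} (hp : p ∈ factors M) :
    p ∣ M.charpoly := by
  obtain ⟨z, hz, rfl⟩ := mem_factors.1 hp
  exact minpoly.dvd _ _ (mem_rootSet'.1 hz).2

lemma mem_rootSet_of_factor {M : Matrix ι ι ℚ} {p : ℚ[X]} (hp : p ∈ factors M) {z : ℂ}
    (hz : aeval z p = 0) : z ∈ M.charpoly.rootSet ℂ := by
  rw [mem_rootSet]
  refine ⟨M.charpoly_monic.ne_zero, ?_⟩
  exact aeval_eq_zero_of_dvd_aeval_eq_zero (dvd_charpoly_of_mem_factors hp) hz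

/-- A cofactor of an irreducible factor of a separable polynomial is coprime to it. -/
lemma exists_cofactor {M : Matrix ι ι ℚ} (hM : M.charpoly.Separable) {p : ℚ[X]}
    (hp : p ∈ factors M) : ∃ q, M.charpoly = p * q ∧ IsCoprime p q := by
  obtain ⟨q, hq⟩ := dvd_charpoly_of_mem_factors hp
  refine ⟨q, hq, ?_⟩
  rw [hq] at hM
  exact hM.isCoprime

lemma isCoprime_of_factor {M : Matrix ι ι ℚ} {p g : ℚ[X]} (hp : p ∈ factors M) {z : ℂ}
    (hz : aeval z p = 0) (hg : aeval z g ≠ 0) : IsCoprime p g := by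
  rw [(irreducible_of_mem_factors hp).coprime_iff_not_dvd]
  exact fun h => hg (aeval_eq_zero_of_dvd_aeval_eq_zero h hz)

lemma dvd_of_factor {M : Matrix ι ι ℚ} {p g : ℚ[X]} (hp : p ∈ factors M) {z : ℂ}
    (hz : aeval z p = 0) (hg : aeval z g = 0) : p ∣ g := by
  rw [← (minpoly_eq_iff hp).2 hz]
  exact minpoly.dvd _ _ hg

lemma exists_root_of_factor {M : Matrix ι ι ℚ} {p : ℚ[X]} (hp : p ∈ factors M) :
    ∃ z ∈ M.charpoly.rootSet ℂ, aeval z p = 0 := by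
  obtain ⟨z, hz, rfl⟩ := mem_factors.1 hp
  exact ⟨z, hz, minpoly.aeval _ _⟩

/-- A matrix without multiple eigenvalues has a cyclic vector: it suffices to avoid the proper
subspaces `ker (f / p)(M)`, where `p` runs over the irreducible factors of the characteristic
polynomial `f`. -/
lemma exists_cyclic_vector {M : Matrix ι ι ℚ} (hM : M.charpoly.Separable) :
    ∃ v : ι → ℚ, ∀ g : ℚ[X], aeval M g *ᵥ v = 0 → aeval M g = 0 := by
  classical
  choose! q hq hcop using fun p (hp : p ∈ factors M) => exists_cofactor hM hp
  let s : Finset (Submodule ℚ (ι → ℚ)) :=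
    (factors M).image fun p => LinearMap.ker (Matrix.toLin' (aeval M (q p)))
  have hs : ⊤ ∉ s := by
    intro h
    obtain ⟨p, hp, h⟩ := Finset.mem_image.1 h
    rw [LinearMap.ker_eq_top, map_eq_zero_iff _ (LinearEquiv.injective _)] at h
    obtain ⟨z, hz, hzp⟩ := exists_root_of_factor hp
    have h1 := aeval_root_eq_zero h hz
    obtain ⟨a, b, hab⟩ := hcop p hp
    have := congrArg (aeval z) hab
    simp [hzp, h1] at this
  have hne := Subspace.biUnion_ne_univ_of_top_notMem hs
  obtain ⟨v, hv⟩ := (Set.ne_univ_iff_exists_notMem _).1 hne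
  refine ⟨v, fun g hg => ?_⟩
  by_contra hg0
  rw [aeval_eq_zero_iff hM] at hg0
  push Not at hg0
  obtain ⟨z, hz, hgz⟩ := hg0
  have hp : minpoly ℚ z ∈ factors M := mem_factors.2 ⟨z, hz, rfl⟩
  set p := minpoly ℚ z with hpdef
  obtain ⟨a, b, hab⟩ := isCoprime_of_factor hp (minpoly.aeval ℚ z) hgz
  apply hv
  simp only [Set.mem_iUnion]
  refine ⟨_, Finset.mem_image_of_mem _ hp, ?_⟩
  simp only [SetLike.mem_coe, LinearMap.mem_ker, Matrix.toLin'_apply]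
  have h1 : q p = a * M.charpoly + q p * b * g := by
    rw [hq p hp]; linear_combination (q p) * -hab
  rw [h1, map_add, map_mul, map_mul, Matrix.aeval_self_charpoly, mul_zero, zero_add,
    ← Matrix.mulVec_mulVec, hg, Matrix.mulVec_zero]

lemma exists_cyclic_vector_surjective {M : Matrix ι ι ℚ} (hM : M.charpoly.Separable) :
    ∃ v : ι → ℚ, (∀ g : ℚ[X], aeval M g *ᵥ v = 0 → aeval M g = 0) ∧
      ∀ w, ∃ g : ℚ[X], w = aeval M g *ᵥ v := by
  obtain ⟨v, hv⟩ := exists_cyclic_vector hM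
  refine ⟨v, hv, ?_⟩
  let L : degreeLT ℚ (Fintype.card ι) →ₗ[ℚ] (ι → ℚ) :=
    { toFun := fun g => aeval M (g : ℚ[X]) *ᵥ v
      map_add' := fun g h => by simp [Matrix.add_mulVec]
      map_smul' := fun c g => by simp [Matrix.smul_mulVec] }
  have hinj : Function.Injective L := by
    rw [← LinearMap.ker_eq_bot, LinearMap.ker_eq_bot']
    intro g hg
    have h0 := hv _ hg
    have hd : M.charpoly ∣ (g : ℚ[X]) := by
      rw [← map_dvd_map' (algebraMap ℚ ℂ)]
      exact charpoly_map_dvd_of_roots hM fun z hz => by simpa using aeval_root_eq_zero h0 hz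
    have hdeg := mem_degreeLT.1 g.2
    replace hdeg : (g : ℚ[X]).degree < M.charpoly.degree := by
      rwa [degree_eq_natDegree M.charpoly_monic.ne_zero, M.charpoly_natDegree_eq_dim]
    exact Subtype.ext (eq_zero_of_dvd_of_degree_lt hd hdeg)
  have hsurj : Function.Surjective L := by
    rw [← LinearMap.injective_iff_surjective_of_finrank_eq_finrank]
    · exact hinj
    · rw [(degreeLTEquiv ℚ (Fintype.card ι)).finrank_eq]; simp
  intro w
  obtain ⟨g, rfl⟩ := hsurj w
  exact ⟨g, rfl⟩

/-- The commutant of a matrix without multiple eigenvalues consists of its polynomials. -/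
lemma exists_polynomial_of_commute {M : Matrix ι ι ℚ} (hM : M.charpoly.Separable)
    {B : Matrix ι ι ℚ} (hB : Commute B M) : ∃ g : ℚ[X], B = aeval M g := by
  obtain ⟨v, -, hv⟩ := exists_cyclic_vector_surjective hM
  obtain ⟨g, hg⟩ := hv (B *ᵥ v)
  refine ⟨g, Matrix.toLin'.injective (LinearMap.ext fun w => ?_)⟩
  obtain ⟨h, rfl⟩ := hv w
  have hc : B * aeval M h = aeval M h * B := by
    induction h using Polynomial.induction_on' with
    | add p q hp hq => simp [mul_add, add_mul, hp, hq]
    | monomial n a =>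
      rw [aeval_monomial]
      have h1 := hB.pow_right n
      rw [← Algebra.smul_def, mul_smul_comm, smul_mul_assoc, h1.eq]
  simp only [Matrix.toLin'_apply, Matrix.mulVec_mulVec]
  rw [hc, ← Matrix.mulVec_mulVec, hg, Matrix.mulVec_mulVec, ← map_mul, ← map_mul, mul_comm]

end EtaleAlgebra

/-! ### Irreducible invariant subspaces -/

section InvariantSubspaces

/-- An integer matrix, regarded as a rational matrix. -/
abbrev ratMatrix {ι : Type*} (A : Matrix ι ι ℤ) : Matrix ι ι ℚ := A.map (Int.cast : ℤ → ℚ)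

variable {ι : Type*} [Fintype ι] [DecidableEq ι]

lemma IsInvariant.aeval_mem {A : Matrix ι ι ℤ} {W : Submodule ℚ (ι → ℚ)} (hW : IsInvariant A W)
    (g : ℚ[X]) {v : ι → ℚ} (hv : v ∈ W) : aeval (ratMatrix A) g *ᵥ v ∈ W := by
  induction g using Polynomial.induction_on generalizing v with
  | C a =>
    rw [aeval_C, Algebra.algebraMap_eq_smul_one, Matrix.smul_mulVec, Matrix.one_mulVec]
    exact W.smul_mem a hv
  | add p q hp hq => simpa [Matrix.add_mulVec] using W.add_mem (hp hv) (hq hv)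
  | monomial n a ih =>
    rw [pow_succ, ← mul_assoc, map_mul, aeval_X, ← Matrix.mulVec_mulVec]
    exact ih (hW v hv)

/-- The subspace `ker p(M)`. -/
noncomputable def primarySubspace (M : Matrix ι ι ℚ) (p : ℚ[X]) : Submodule ℚ (ι → ℚ) :=
  LinearMap.ker (Matrix.toLin' (aeval M p))

lemma mem_primarySubspace {M : Matrix ι ι ℚ} {p : ℚ[X]} {v : ι → ℚ} :
    v ∈ primarySubspace M p ↔ aeval M p *ᵥ v = 0 := by
  simp [primarySubspace]

lemma aeval_mulVec_comm (M : Matrix ι ι ℚ) (p q : ℚ[X]) (v : ι → ℚ) :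
    aeval M p *ᵥ (aeval M q *ᵥ v) = aeval M q *ᵥ (aeval M p *ᵥ v) := by
  rw [Matrix.mulVec_mulVec, Matrix.mulVec_mulVec, ← map_mul, ← map_mul, mul_comm]

lemma bezout_mulVec {M : Matrix ι ι ℚ} {p q a b : ℚ[X]} (h : a * p + b * q = 1) (v : ι → ℚ) :
    aeval M a *ᵥ (aeval M p *ᵥ v) + aeval M b *ᵥ (aeval M q *ᵥ v) = v := by
  rw [Matrix.mulVec_mulVec, Matrix.mulVec_mulVec, ← map_mul, ← map_mul, ← Matrix.add_mulVec,
    ← map_add, h, map_one, Matrix.one_mulVec]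

lemma isInvariant_primarySubspace (A : Matrix ι ι ℤ) (p : ℚ[X]) :
    IsInvariant A (primarySubspace (ratMatrix A) p) := by
  intro v hv
  rw [mem_primarySubspace] at hv ⊢
  have := aeval_mulVec_comm (ratMatrix A) p X v
  rw [aeval_X, hv, Matrix.mulVec_zero] at this
  exact this

lemma isIrreducibleInvariant_primarySubspace {A : Matrix ι ι ℤ}
    (hA : (ratMatrix A).charpoly.Separable) {p : ℚ[X]} (hp : p ∈ factors (ratMatrix A)) :
    IsIrreducibleInvariant A (primarySubspace (ratMatrix A) p) := by
  set M := ratMatrix A with hMdef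
  obtain ⟨v, hv, hsurj⟩ := exists_cyclic_vector_surjective hA
  refine ⟨isInvariant_primarySubspace A p, ?_, fun U hU hinv => ?_⟩
  · obtain ⟨q, hq, a, b, hab⟩ := exists_cofactor hA hp
    obtain ⟨z, hz, hzp⟩ := exists_root_of_factor hp
    intro hbot
    have hmem : aeval M q *ᵥ v ∈ primarySubspace M p := by
      rw [mem_primarySubspace, Matrix.mulVec_mulVec, ← map_mul, ← hq, Matrix.aeval_self_charpoly,
        Matrix.zero_mulVec]
    rw [hbot, Submodule.mem_bot] at hmem
    have h1 := aeval_root_eq_zero (hv _ hmem) hz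
    simpa [h1, hzp] using congrArg (aeval z) hab
  · rw [or_iff_not_imp_left]
    intro hne
    obtain ⟨u, huU, hu0⟩ := Submodule.exists_mem_ne_zero_of_ne_bot hne
    refine le_antisymm hU fun w hw => ?_
    obtain ⟨g, rfl⟩ := hsurj u
    obtain ⟨h, rfl⟩ := hsurj w
    have hg : aeval M g ≠ 0 := fun h0 => hu0 (by rw [h0, Matrix.zero_mulVec])
    rw [Ne, aeval_eq_zero_iff hA] at hg
    push Not at hg
    obtain ⟨z, hz, hgz⟩ := hg
    have hpz : aeval z p = 0 := by
      have h1 := mem_primarySubspace.1 (hU huU)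
      rw [Matrix.mulVec_mulVec, ← map_mul] at h1
      have h2 := aeval_root_eq_zero (hv _ h1) hz
      rw [map_mul] at h2
      exact (mul_eq_zero.1 h2).resolve_right hgz
    obtain ⟨a, b, hab⟩ := isCoprime_of_factor hp hpz hgz
    rw [← bezout_mulVec hab (aeval M h *ᵥ v), mem_primarySubspace.1 hw, Matrix.mulVec_zero,
      zero_add, aeval_mulVec_comm M g h]
    exact hinv.aeval_mem _ (hinv.aeval_mem _ huU)

lemma IsIrreducibleInvariant.exists_factor {A : Matrix ι ι ℤ}
    (hA : (ratMatrix A).charpoly.Separable) {W : Submodule ℚ (ι → ℚ)}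
    (hW : IsIrreducibleInvariant A W) :
    ∃ p ∈ factors (ratMatrix A), primarySubspace (ratMatrix A) p = W := by
  set M := ratMatrix A with hMdef
  obtain ⟨v, hv, hsurj⟩ := exists_cyclic_vector_surjective hA
  obtain ⟨hinv, hne, hmin⟩ := hW
  obtain ⟨w, hwW, hw0⟩ := Submodule.exists_mem_ne_zero_of_ne_bot hne
  obtain ⟨g, rfl⟩ := hsurj w
  have hg : aeval M g ≠ 0 := fun h0 => hw0 (by rw [h0, Matrix.zero_mulVec])
  rw [Ne, aeval_eq_zero_iff hA] at hg
  push Not at hg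
  obtain ⟨z, hz, hgz⟩ := hg
  have hp : minpoly ℚ z ∈ factors M := mem_factors.2 ⟨z, hz, rfl⟩
  refine ⟨_, hp, ?_⟩
  obtain ⟨q, hq, a, b, hab⟩ := exists_cofactor hA hp
  have hmem : aeval M q *ᵥ (aeval M g *ᵥ v) ∈ primarySubspace M (minpoly ℚ z) := by
    rw [mem_primarySubspace, Matrix.mulVec_mulVec, ← map_mul, ← hq, Matrix.aeval_self_charpoly,
      Matrix.zero_mulVec]
  have hnz : aeval M q *ᵥ (aeval M g *ᵥ v) ≠ 0 := by
    intro h0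
    rw [Matrix.mulVec_mulVec, ← map_mul] at h0
    have h1 := aeval_root_eq_zero (hv _ h0) hz
    rw [map_mul] at h1
    have h2 := (mul_eq_zero.1 h1).resolve_right hgz
    simpa [h2] using congrArg (aeval z) hab
  have hle : W ≤ primarySubspace M (minpoly ℚ z) := by
    rcases hmin (W ⊓ primarySubspace M (minpoly ℚ z)) inf_le_left (fun x hx =>
      ⟨hinv x hx.1, isInvariant_primarySubspace A _ x hx.2⟩) with h | h
    · exfalso
      have : aeval M q *ᵥ (aeval M g *ᵥ v) ∈ W ⊓ primarySubspace M (minpoly ℚ z) :=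
        ⟨hinv.aeval_mem q hwW, hmem⟩
      rw [h, Submodule.mem_bot] at this
      exact hnz this
    · exact inf_eq_left.1 h
  rcases (isIrreducibleInvariant_primarySubspace hA hp).2.2 W hle hinv with h | h
  · exact absurd h hne
  · exact h.symm

lemma primarySubspace_injOn {A : Matrix ι ι ℤ} (hA : (ratMatrix A).charpoly.Separable) :
    Set.InjOn (primarySubspace (ratMatrix A)) (factors (ratMatrix A)) := by
  intro p hp p' hp' h
  by_contra hne
  obtain ⟨z, -, hzp⟩ := exists_root_of_factor hp
  have hzp' : aeval z p' ≠ 0 := fun h0 => hne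
    (((minpoly_eq_iff hp).2 hzp).symm.trans ((minpoly_eq_iff hp').2 h0))
  obtain ⟨a, b, hab⟩ := isCoprime_of_factor hp hzp hzp'
  obtain ⟨u, hu, hu0⟩ := Submodule.exists_mem_ne_zero_of_ne_bot
    (isIrreducibleInvariant_primarySubspace hA hp).2.1
  have hu' : u ∈ primarySubspace (ratMatrix A) p' := h ▸ hu
  rw [mem_primarySubspace] at hu hu'
  apply hu0
  rw [← bezout_mulVec hab u, hu, hu', Matrix.mulVec_zero, Matrix.mulVec_zero, add_zero]

end InvariantSubspaces

/-! ### The symplectic adjoint and reciprocal eigenvalues -/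

section SymplecticAdjoint

variable {l : Type*} [Fintype l] [DecidableEq l] {R : Type*} [CommRing R]

/-- The adjoint `-J Xᵀ J` of a matrix with respect to the standard symplectic form. -/
def symplecticAdjoint (X : Matrix (l ⊕ l) (l ⊕ l) R) : Matrix (l ⊕ l) (l ⊕ l) R :=
  -(Matrix.J l R * Xᵀ * Matrix.J l R)

lemma symplecticAdjoint_add (X Y : Matrix (l ⊕ l) (l ⊕ l) R) :
    symplecticAdjoint (X + Y) = symplecticAdjoint X + symplecticAdjoint Y := by
  simp [symplecticAdjoint, mul_add, add_mul, add_comm]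

lemma symplecticAdjoint_mul (X Y : Matrix (l ⊕ l) (l ⊕ l) R) :
    symplecticAdjoint (X * Y) = symplecticAdjoint Y * symplecticAdjoint X := by
  have h : Matrix.J l R * Yᵀ * Matrix.J l R * (Matrix.J l R * Xᵀ * Matrix.J l R) =
      Matrix.J l R * Yᵀ * (Matrix.J l R * Matrix.J l R) * Xᵀ * Matrix.J l R := by
    simp only [mul_assoc]
  rw [symplecticAdjoint, symplecticAdjoint, symplecticAdjoint, neg_mul_neg, h, Matrix.J_squared]
  simp [mul_assoc]

lemma symplecticAdjoint_smul_one (c : R) :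
    symplecticAdjoint (c • (1 : Matrix (l ⊕ l) (l ⊕ l) R)) = c • 1 := by
  simp [symplecticAdjoint, Matrix.J_squared]

lemma mul_symplecticAdjoint_eq_one_iff {X : Matrix (l ⊕ l) (l ⊕ l) R} :
    X * symplecticAdjoint X = 1 ↔ X ∈ Matrix.symplecticGroup l R := by
  rw [SymplecticGroup.mem_iff, symplecticAdjoint]
  constructor
  · intro h
    have := congrArg (· * Matrix.J l R) h
    simp only [mul_neg, neg_mul, one_mul] at this
    rw [mul_assoc, mul_assoc _ (Matrix.J l R) (Matrix.J l R), Matrix.J_squared] at this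
    simpa [mul_assoc] using this
  · intro h
    rw [mul_neg, ← mul_assoc, ← mul_assoc, h, Matrix.J_squared, neg_neg]

lemma map_symplecticAdjoint {S : Type*} [CommRing S] (φ : R →+* S)
    (X : Matrix (l ⊕ l) (l ⊕ l) R) :
    (symplecticAdjoint X).map φ = symplecticAdjoint (X.map φ) := by
  rw [symplecticAdjoint, symplecticAdjoint, Matrix.map_neg _ (map_neg φ), Matrix.map_mul,
    Matrix.map_mul, Matrix.transpose_map, Matrix.map_J]

lemma mulVec_dotProduct_J (X : Matrix (l ⊕ l) (l ⊕ l) R) (v w : l ⊕ l → R) :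
    (X *ᵥ v) ⬝ᵥ (Matrix.J l R *ᵥ w) =
      v ⬝ᵥ (Matrix.J l R *ᵥ (symplecticAdjoint X *ᵥ w)) := by
  rw [symplecticAdjoint, Matrix.mulVec_mulVec, mul_neg, ← mul_assoc, ← mul_assoc,
    Matrix.J_squared, Matrix.neg_mul, Matrix.one_mul, Matrix.neg_mul, neg_neg,
    ← Matrix.mulVec_mulVec, Matrix.dotProduct_mulVec _ Xᵀ, Matrix.vecMul_transpose]

lemma dotProduct_J_self (v : l ⊕ l → R) : v ⬝ᵥ (Matrix.J l R *ᵥ v) = 0 := by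
  simp only [Matrix.J, dotProduct, Matrix.mulVec, Fintype.sum_sum_type]
  simp [Matrix.one_apply, mul_comm]

lemma dotProduct_J_comm (v w : l ⊕ l → R) :
    v ⬝ᵥ (Matrix.J l R *ᵥ w) = -(w ⬝ᵥ (Matrix.J l R *ᵥ v)) := by
  have := dotProduct_J_self (v + w)
  rw [Matrix.mulVec_add, add_dotProduct, dotProduct_add, dotProduct_add, dotProduct_J_self,
    dotProduct_J_self] at this
  linear_combination this

lemma eq_zero_of_forall_dotProduct_J {v : l ⊕ l → R}
    (h : ∀ w, v ⬝ᵥ (Matrix.J l R *ᵥ w) = 0) : v = 0 := by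
  refine dotProduct_eq_zero v fun w => ?_
  have := h (-(Matrix.J l R *ᵥ w))
  rwa [Matrix.mulVec_neg, Matrix.mulVec_mulVec, Matrix.J_squared, Matrix.neg_mulVec,
    Matrix.one_mulVec, neg_neg] at this

end SymplecticAdjoint

section SymplecticEigenvalues

variable {l : Type*} [Fintype l] [DecidableEq l] {M : Matrix (l ⊕ l) (l ⊕ l) ℚ}

/-- The inverse of a symplectic matrix without multiple eigenvalues is a polynomial in it. -/
lemma exists_adjoint_polynomial (hM : M.charpoly.Separable) (hS : M ∈ Matrix.symplecticGroup l ℚ) :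
    ∃ b : ℚ[X], aeval M b = symplecticAdjoint M := by
  have h1 := mul_symplecticAdjoint_eq_one_iff.2 hS
  obtain ⟨b, hb⟩ := exists_polynomial_of_commute hM (B := symplecticAdjoint M)
    ((mul_eq_one_comm.1 h1).trans h1.symm)
  exact ⟨b, hb.symm⟩

/-- A polynomial `b` with `b(M) = M⁻¹`; composition with `b` is the involution of `ℚ[M]` that the
symplectic adjoint induces. -/
noncomputable def adjointPoly (hM : M.charpoly.Separable) (hS : M ∈ Matrix.symplecticGroup l ℚ) :
    ℚ[X] :=
  (exists_adjoint_polynomial hM hS).choose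

lemma aeval_adjointPoly (hM : M.charpoly.Separable) (hS : M ∈ Matrix.symplecticGroup l ℚ) :
    aeval M (adjointPoly hM hS) = symplecticAdjoint M :=
  (exists_adjoint_polynomial hM hS).choose_spec

lemma aeval_comp_adjointPoly (hM : M.charpoly.Separable) (hS : M ∈ Matrix.symplecticGroup l ℚ)
    (g : ℚ[X]) : aeval M (g.comp (adjointPoly hM hS)) = symplecticAdjoint (aeval M g) := by
  induction g using Polynomial.induction_on with
  | C a =>
    rw [C_comp, aeval_C, Algebra.algebraMap_eq_smul_one, symplecticAdjoint_smul_one]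
  | add p q hp hq => rw [add_comp, map_add, hp, hq, map_add, symplecticAdjoint_add]
  | monomial n a ih =>
    rw [pow_succ, ← mul_assoc, mul_comp, map_mul, ih, X_comp, aeval_adjointPoly,
      ← symplecticAdjoint_mul]
    nth_rewrite 1 [← aeval_X (R := ℚ) M]
    rw [← map_mul, mul_comm]

lemma aeval_adjointPoly_root (hM : M.charpoly.Separable) (hS : M ∈ Matrix.symplecticGroup l ℚ)
    {z : ℂ} (hz : z ∈ M.charpoly.rootSet ℂ) : aeval z (adjointPoly hM hS) = z⁻¹ := by
  have h : aeval M (X * adjointPoly hM hS - 1) = 0 := by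
    rw [map_sub, map_mul, aeval_X, map_one, aeval_adjointPoly,
      mul_symplecticAdjoint_eq_one_iff.2 hS, sub_self]
  have h2 := aeval_root_eq_zero h hz
  rw [map_sub, map_mul, aeval_X, map_one, sub_eq_zero] at h2
  exact eq_inv_of_mul_eq_one_right h2

lemma aeval_root_comp_adjointPoly (hM : M.charpoly.Separable)
    (hS : M ∈ Matrix.symplecticGroup l ℚ) (g : ℚ[X]) {z : ℂ} (hz : z ∈ M.charpoly.rootSet ℂ) :
    aeval z (g.comp (adjointPoly hM hS)) = aeval z⁻¹ g := by
  rw [aeval_comp, aeval_adjointPoly_root hM hS hz]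

lemma inv_mem_rootSet (hM : M.charpoly.Separable) (hS : M ∈ Matrix.symplecticGroup l ℚ)
    {z : ℂ} (hz : z ∈ M.charpoly.rootSet ℂ) : z⁻¹ ∈ M.charpoly.rootSet ℂ := by
  rw [mem_rootSet]
  refine ⟨M.charpoly_monic.ne_zero, ?_⟩
  rw [← aeval_root_comp_adjointPoly hM hS _ hz]
  refine aeval_root_eq_zero ?_ hz
  rw [aeval_comp_adjointPoly, Matrix.aeval_self_charpoly]
  simp [symplecticAdjoint]

lemma root_ne_zero (hM : M.charpoly.Separable) (hS : M ∈ Matrix.symplecticGroup l ℚ)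
    {z : ℂ} (hz : z ∈ M.charpoly.rootSet ℂ) : z ≠ 0 := by
  have h : aeval M (X * adjointPoly hM hS - 1) = 0 := by
    rw [map_sub, map_mul, aeval_X, map_one, aeval_adjointPoly,
      mul_symplecticAdjoint_eq_one_iff.2 hS, sub_self]
  have h2 := aeval_root_eq_zero h hz
  rintro rfl
  simp at h2

lemma conj_mem_rootSet {ι : Type*} [Fintype ι] [DecidableEq ι] {M : Matrix ι ι ℚ}
    {z : ℂ} (hz : z ∈ M.charpoly.rootSet ℂ) :
    (starRingEnd ℂ) z ∈ M.charpoly.rootSet ℂ := by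
  rw [mem_rootSet] at hz ⊢
  refine ⟨hz.1, ?_⟩
  have := aeval_algHom_apply (Complex.conjAe.toAlgHom.restrictScalars ℚ) z M.charpoly
  rw [hz.2, map_zero] at this
  exact this

end SymplecticEigenvalues

section Isotropic

variable {d : ℕ} {A : Matrix (Fin d ⊕ Fin d) (Fin d ⊕ Fin d) ℤ}

/-- If `p` has no root in common with its reciprocal, then `ker p(A)` is isotropic: the adjoint of
`p(A)` acts invertibly on `ker p(A)`. -/
lemma isIsotropic_of_root_inv (hM : (ratMatrix A).charpoly.Separable)
    (hS : ratMatrix A ∈ Matrix.symplecticGroup (Fin d) ℚ) {p : ℚ[X]}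
    (hp : p ∈ factors (ratMatrix A)) {z : ℂ} (hz : z ∈ (ratMatrix A).charpoly.rootSet ℂ)
    (hzp : aeval z p = 0) (hzi : aeval z⁻¹ p ≠ 0) :
    IsIsotropic (primarySubspace (ratMatrix A) p) := by
  intro v hv w hw
  rw [mem_primarySubspace] at hv hw
  rw [← aeval_root_comp_adjointPoly hM hS p hz] at hzi
  obtain ⟨a, b, hab⟩ := isCoprime_of_factor hp hzp hzi
  rw [← bezout_mulVec hab w, hw, Matrix.mulVec_zero, zero_add, aeval_mulVec_comm,
    aeval_comp_adjointPoly, ← mulVec_dotProduct_J, hv, zero_dotProduct]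

lemma not_isIsotropic_of_root_inv (hM : (ratMatrix A).charpoly.Separable)
    (hS : ratMatrix A ∈ Matrix.symplecticGroup (Fin d) ℚ) {p : ℚ[X]}
    (hp : p ∈ factors (ratMatrix A)) {z : ℂ} (hz : z ∈ (ratMatrix A).charpoly.rootSet ℂ)
    (hzp : aeval z p = 0) (hzi : aeval z⁻¹ p = 0) :
    ¬ IsIsotropic (primarySubspace (ratMatrix A) p) := by
  intro hiso
  rw [← aeval_root_comp_adjointPoly hM hS p hz] at hzi
  obtain ⟨k, hk⟩ := dvd_of_factor hp hzp hzi
  obtain ⟨v, hv, hv0⟩ := Submodule.exists_mem_ne_zero_of_ne_bot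
    (isIrreducibleInvariant_primarySubspace hM hp).2.1
  obtain ⟨q, hq, a, b, hab⟩ := exists_cofactor hM hp
  apply hv0
  -- `ker p(A)` is orthogonal to the image of `p(A)`, which complements it
  refine eq_zero_of_forall_dotProduct_J fun w => ?_
  rw [← bezout_mulVec hab w, Matrix.mulVec_add, dotProduct_add, add_eq_zero_iff_eq_neg]
  have h1 : v ⬝ᵥ (Matrix.J (Fin d) ℚ *ᵥ
      (aeval (ratMatrix A) a *ᵥ (aeval (ratMatrix A) p *ᵥ w))) = 0 := by
    rw [aeval_mulVec_comm, dotProduct_J_comm, mulVec_dotProduct_J, ← aeval_comp_adjointPoly hM hS,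
      hk, mul_comm, map_mul, ← Matrix.mulVec_mulVec, mem_primarySubspace.1 hv]
    simp
  have h2 : v ⬝ᵥ (Matrix.J (Fin d) ℚ *ᵥ
      (aeval (ratMatrix A) b *ᵥ (aeval (ratMatrix A) q *ᵥ w))) = 0 := by
    refine hiso v hv _ ?_
    rw [mem_primarySubspace, aeval_mulVec_comm, Matrix.mulVec_mulVec _ _ (aeval _ q), ← map_mul,
      Matrix.mulVec_mulVec, ← map_mul, ← hq, map_mul, Matrix.aeval_self_charpoly, mul_zero,
      Matrix.zero_mulVec]
  rw [h1, h2, neg_zero]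

/-- The numbers `1` and `-1` are not simple eigenvalues of a symplectic matrix: a one-dimensional
eigenspace is isotropic, while an eigenspace for an eigenvalue `z = z⁻¹` is not. -/
lemma inv_ne_self_of_root (hM : (ratMatrix A).charpoly.Separable)
    (hS : ratMatrix A ∈ Matrix.symplecticGroup (Fin d) ℚ) {z : ℂ}
    (hz : z ∈ (ratMatrix A).charpoly.rootSet ℂ) : z⁻¹ ≠ z := by
  intro hinv
  have hp : minpoly ℚ z ∈ factors (ratMatrix A) := mem_factors.2 ⟨z, hz, rfl⟩
  refine not_isIsotropic_of_root_inv hM hS hp hz (minpoly.aeval _ _)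
    (by rw [hinv]; exact minpoly.aeval _ _) ?_
  have hz0 := root_ne_zero hM hS hz
  have hzz : z * z = 1 := by nth_rewrite 1 [← hinv]; exact inv_mul_cancel₀ hz0
  obtain ⟨c, hc⟩ : ∃ c : ℚ, z = algebraMap ℚ ℂ c := by
    rcases mul_self_eq_one_iff.1 hzz with h | h
    · exact ⟨1, by simp [h]⟩
    · exact ⟨-1, by simp [h]⟩
  rw [hc, minpoly.eq_X_sub_C] at hp ⊢
  set W := primarySubspace (ratMatrix A) (X - C c) with hW
  have hirr := isIrreducibleInvariant_primarySubspace hM hp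
  have heig : ∀ v ∈ W, ratMatrix A *ᵥ v = c • v := by
    intro v hv
    rw [hW, mem_primarySubspace, map_sub, aeval_X, aeval_C, Algebra.algebraMap_eq_smul_one,
      Matrix.sub_mulVec, Matrix.smul_mulVec, Matrix.one_mulVec, sub_eq_zero] at hv
    exact hv
  intro v hv w hw
  rcases eq_or_ne v 0 with rfl | hv0
  · simp
  have hspan : Submodule.span ℚ {v} = W := by
    refine (hirr.2.2 _ ?_ ?_).resolve_left ?_
    · rwa [Submodule.span_singleton_le_iff_mem]
    · intro x hx
      obtain ⟨t, rfl⟩ := Submodule.mem_span_singleton.1 hx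
      rw [show Matrix.map A (Int.cast : ℤ → ℚ) = ratMatrix A from rfl, Matrix.mulVec_smul,
        heig v hv]
      exact Submodule.smul_mem _ _ (Submodule.smul_mem _ _ (Submodule.mem_span_singleton_self v))
    · simpa using hv0
  rw [← hspan] at hw
  obtain ⟨t, rfl⟩ := Submodule.mem_span_singleton.1 hw
  rw [Matrix.mulVec_smul, dotProduct_smul, dotProduct_J_self, smul_zero]

end Isotropic

/-! ### Dirichlet's unit theorem and powers of units in subrings -/

section Dirichlet

open NumberField NumberField.InfinitePlace NumberField.Units
  NumberField.Units.dirichletUnitTheorem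

variable {K : Type*} [Field K]

lemma conj_invariant_eq_of_mk_eq {x : (K →+* ℂ) → ℝ}
    (hconj : ∀ φ, x (ComplexEmbedding.conjugate φ) = x φ) {φ ψ : K →+* ℂ}
    (h : InfinitePlace.mk φ = InfinitePlace.mk ψ) : x φ = x ψ := by
  rcases InfinitePlace.mk_eq_iff.1 h with rfl | h
  · rfl
  · rw [← h, hconj]

variable [NumberField K]

lemma sum_embeddings_eq_sum_places {x : (K →+* ℂ) → ℝ}
    (hconj : ∀ φ, x (ComplexEmbedding.conjugate φ) = x φ) :
    ∑ φ, x φ = ∑ w : InfinitePlace K, (w.mult : ℝ) * x w.embedding := by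
  classical
  rw [← Finset.sum_fiberwise (s := Finset.univ) (g := InfinitePlace.mk)]
  refine Finset.sum_congr rfl fun w _ => ?_
  rw [Finset.sum_congr rfl (g := fun _ => x w.embedding), Finset.sum_const,
    InfinitePlace.card_filter_mk_eq, nsmul_eq_mul]
  intro φ hφ
  refine conj_invariant_eq_of_mk_eq hconj ?_
  rw [(Finset.mem_filter.1 hφ).2, InfinitePlace.mk_embedding]

/-- Dirichlet's unit theorem in terms of embeddings: the logarithms of units span the space of
all conjugation-invariant vectors with sum zero. -/
lemma mem_span_log_units {x : (K →+* ℂ) → ℝ}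
    (hconj : ∀ φ, x (ComplexEmbedding.conjugate φ) = x φ) (hsum : ∑ φ, x φ = 0) :
    x ∈ Submodule.span ℝ
      (Set.range fun (u : (𝓞 K)ˣ) (φ : K →+* ℂ) => Real.log ‖φ (u : K)‖) := by
  classical
  -- recovers all coordinates of a vector in the trace-zero hyperplane from those off `w₀`
  let T : logSpace K →ₗ[ℝ] ((K →+* ℂ) → ℝ) :=
    { toFun := fun y φ => if h : InfinitePlace.mk φ ≠ w₀ then
          y ⟨InfinitePlace.mk φ, h⟩ / (InfinitePlace.mk φ).mult
        else -(∑ w, y w) / (w₀ : InfinitePlace K).mult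
      map_add' := fun y y' => by
        funext φ
        by_cases h : InfinitePlace.mk φ ≠ w₀
        · simp [h, add_div]
        · simp only [h, dite_false, Pi.add_apply, Finset.sum_add_distrib, neg_add, add_div]
      map_smul' := fun c y => by
        funext φ
        by_cases h : InfinitePlace.mk φ ≠ w₀
        · simp [h, mul_div_assoc]
        · simp only [h, dite_false, Pi.smul_apply, smul_eq_mul, ← Finset.mul_sum,
            RingHom.id_apply, ← mul_neg, mul_div_assoc] }
  have hmult : ∀ w : InfinitePlace K, (w.mult : ℝ) ≠ 0 := fun w => mult_coe_ne_zero
  have hTlog : ∀ u : (𝓞 K)ˣ, T (logEmbedding K (Additive.ofMul u)) =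
      fun φ => Real.log ‖φ (u : K)‖ := by
    intro u
    funext φ
    by_cases h : InfinitePlace.mk φ ≠ w₀
    · simp only [T, LinearMap.coe_mk, AddHom.coe_mk, logEmbedding_component]
      rw [dif_pos h, mul_div_cancel_left₀ _ (hmult _), InfinitePlace.apply]
    · simp only [T, LinearMap.coe_mk, AddHom.coe_mk, h, dite_false]
      rw [sum_logEmbedding_component, neg_mul, neg_neg, mul_div_cancel_left₀ _ (hmult _)]
      push Not at h
      rw [← h, InfinitePlace.apply]
  let y : logSpace K := fun w => (w.1.mult : ℝ) * x w.1.embedding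
  have hTy : T y = x := by
    funext φ
    by_cases h : InfinitePlace.mk φ ≠ w₀
    · simp only [T, LinearMap.coe_mk, AddHom.coe_mk, y]
      rw [dif_pos h, mul_div_cancel_left₀ _ (hmult _)]
      exact conj_invariant_eq_of_mk_eq hconj (InfinitePlace.mk_embedding _)
    · simp only [T, LinearMap.coe_mk, AddHom.coe_mk, h, dite_false, y]
      rw [sum_embeddings_eq_sum_places hconj, Fintype.sum_eq_add_sum_subtype_ne _ w₀,
        add_comm, add_eq_zero_iff_eq_neg] at hsum
      rw [hsum, neg_neg, mul_div_cancel_left₀ _ (hmult _)]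
      push Not at h
      exact conj_invariant_eq_of_mk_eq hconj ((InfinitePlace.mk_embedding _).trans h.symm)
  have hy : y ∈ Submodule.span ℝ (unitLattice K : Set (logSpace K)) := by
    rw [unitLattice_span_eq_top]; trivial
  have := Submodule.mem_map_of_mem (f := T) hy
  rw [hTy, Submodule.map_span] at this
  refine Submodule.span_mono ?_ this
  rintro _ ⟨_, ⟨u, -, rfl⟩, rfl⟩
  exact ⟨u.toMul, (hTlog _).symm⟩

end Dirichlet

section Commensurability

/-- A unit that is integral together with its inverse has a positive power in any subring that
contains a nonzero integer multiple of every element: modulo such a multiple, it is a unit of a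
finite ring. -/
lemma exists_pow_mem_subring {E : Type*} [CommRing E] (S : Subring E)
    (hS : ∀ e : E, ∃ N : ℕ, 0 < N ∧ (N : E) * e ∈ S) {u u' : E} (huu' : u * u' = 1)
    (hu : IsIntegral ℤ u) (hu' : IsIntegral ℤ u') :
    ∃ k : ℕ, 0 < k ∧ u ^ k ∈ S ∧ u' ^ k ∈ S := by
  classical
  let T : Subalgebra ℤ E := Algebra.adjoin ℤ {u, u'}
  have hfg : (Subalgebra.toSubmodule T).FG :=
    fg_adjoin_of_finite (by simp) (by rintro x (rfl | rfl) <;> assumption)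
  have : Module.Finite ℤ T := Module.Finite.iff_fg.2 hfg
  obtain ⟨s, hs⟩ := hfg
  -- a common denominator for the whole ring
  obtain ⟨N, hN, hNT⟩ : ∃ N : ℕ, 0 < N ∧ ∀ t ∈ T, (N : E) * t ∈ S := by
    choose n hn hnS using hS
    refine ⟨∏ e ∈ s, n e, Finset.prod_pos fun e _ => hn e, fun t ht => ?_⟩
    have ht' : t ∈ Submodule.span ℤ (s : Set E) := by rw [hs]; exact ht
    clear ht
    induction ht' using Submodule.span_induction with
    | mem x hx =>
      obtain ⟨m, hm⟩ := Finset.dvd_prod_of_mem n hx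
      rw [hm, mul_comm (n x), Nat.cast_mul, mul_assoc]
      exact S.mul_mem (natCast_mem S m) (hnS x)
    | zero => simp
    | add x y _ _ hx hy =>
      rw [mul_add]
      exact S.add_mem hx hy
    | smul a x _ hx =>
      rw [mul_smul_comm]
      exact S.zsmul_mem hx a
  let I : Ideal T := Ideal.span {(N : T)}
  have hfin : Finite (T ⧸ I) := by
    have : Module.Finite ℤ (T ⧸ I) := Module.Finite.of_surjective
      ((Ideal.Quotient.mk I).toAddMonoidHom.toIntLinearMap) Ideal.Quotient.mk_surjective
    refine Module.finite_of_fg_torsion (T ⧸ I) ?_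
    intro x
    refine ⟨⟨(N : ℤ), mem_nonZeroDivisors_of_ne_zero (by exact_mod_cast hN.ne')⟩, ?_⟩
    obtain ⟨t, rfl⟩ := Ideal.Quotient.mk_surjective x
    change (N : ℤ) • Ideal.Quotient.mk I t = 0
    rw [← map_zsmul, Ideal.Quotient.eq_zero_iff_mem, zsmul_eq_mul, Ideal.mem_span_singleton]
    exact ⟨t, by simp⟩
  have huT : u ∈ T := Algebra.subset_adjoin (by simp)
  have huT' : u' ∈ T := Algebra.subset_adjoin (by simp)
  let U : (T ⧸ I)ˣ := Units.map (Ideal.Quotient.mk I).toMonoidHom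
    ⟨⟨u, huT⟩, ⟨u', huT'⟩, Subtype.ext huu', Subtype.ext ((mul_comm _ _).trans huu')⟩
  have hpow : U ^ Nat.card (T ⧸ I)ˣ = 1 := pow_card_eq_one'
  have key : ∀ t : T, Ideal.Quotient.mk I t = 1 → (t : E) ∈ S := by
    intro t ht
    rw [← map_one (Ideal.Quotient.mk I), Ideal.Quotient.eq, Ideal.mem_span_singleton] at ht
    obtain ⟨r, hr⟩ := ht
    have : (t : E) = 1 + (N : E) * (r : E) := by
      have := congrArg (Subtype.val) hr
      push_cast at this
      linear_combination this
    rw [this]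
    exact S.add_mem S.one_mem (hNT _ r.2)
  refine ⟨Nat.card (T ⧸ I)ˣ, Nat.card_pos, ?_, ?_⟩
  · refine key (⟨u, huT⟩ ^ Nat.card (T ⧸ I)ˣ) ?_
    rw [map_pow]
    exact congrArg Units.val hpow
  · refine key (⟨u', huT'⟩ ^ Nat.card (T ⧸ I)ˣ) ?_
    have h2 : U⁻¹ ^ Nat.card (T ⧸ I)ˣ = 1 := by rw [inv_pow, hpow, inv_one]
    rw [map_pow]
    exact congrArg Units.val h2

end Commensurability

/-! ### Logarithms of units of the order of integer polynomials in a matrix -/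

section IntegralUnits

variable {ι : Type*} [Fintype ι] [DecidableEq ι]

/-- The subring of integer matrices inside the rational matrices. -/
noncomputable def integerMatrices (ι : Type*) [Fintype ι] [DecidableEq ι] :
    Subring (Matrix ι ι ℚ) :=
  (Int.castRingHom ℚ).mapMatrix.range

lemma mem_integerMatrices {X : Matrix ι ι ℚ} :
    X ∈ integerMatrices ι ↔ ∃ B : Matrix ι ι ℤ, ratMatrix B = X := Iff.rfl

lemma exists_mul_mem_integerMatrices (X : Matrix ι ι ℚ) :
    ∃ N : ℕ, 0 < N ∧ (N : Matrix ι ι ℚ) * X ∈ integerMatrices ι := by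
  refine ⟨∏ i, ∏ j, (X i j).den, Finset.prod_pos fun i _ => Finset.prod_pos fun j _ =>
    (X i j).den_pos, ?_⟩
  have h : ∀ i j, ∃ b : ℤ, (b : ℚ) = ((∏ i, ∏ j, (X i j).den : ℕ) : ℚ) * X i j := by
    intro i j
    obtain ⟨m, hm⟩ : (X i j).den ∣ ∏ i, ∏ j, (X i j).den :=
      (Finset.dvd_prod_of_mem (fun j => (X i j).den) (Finset.mem_univ j)).trans
        (Finset.dvd_prod_of_mem (fun i => ∏ j, (X i j).den) (Finset.mem_univ i))
    refine ⟨m * (X i j).num, ?_⟩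
    rw [hm]
    push_cast
    rw [mul_comm ((X i j).den : ℚ), mul_assoc, Rat.den_mul_eq_num]
  choose b hb using h
  refine mem_integerMatrices.2 ⟨Matrix.of b, ?_⟩
  ext i j
  rw [← nsmul_eq_mul, Matrix.smul_apply, nsmul_eq_mul, ← hb]
  rfl

/-- A polynomial in a matrix without multiple eigenvalues is integral if its eigenvalues are
annihilated by a common monic integer polynomial. -/
lemma isIntegral_aeval_of_roots {M : Matrix ι ι ℚ} (hM : M.charpoly.Separable) {g : ℚ[X]}
    {P : ℤ[X]} (hP : P.Monic) (h : ∀ z ∈ M.charpoly.rootSet ℂ, aeval (aeval z g) P = 0) :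
    IsIntegral ℤ (aeval M g) := by
  refine ⟨P, hP, ?_⟩
  rw [← aeval_def, ← aeval_map_algebraMap ℚ, ← aeval_comp, aeval_eq_zero_iff hM]
  intro z hz
  rw [aeval_comp, aeval_map_algebraMap]
  exact h z hz

/-- The polynomials representing units of the ring of integer polynomials in `M`, that is, of
`ℚ[M] ∩ Mₙ(ℤ)`. -/
def IsIntegerUnit (M : Matrix ι ι ℚ) (g : ℚ[X]) : Prop :=
  aeval M g ∈ integerMatrices ι ∧
    ∃ g' : ℚ[X], aeval M (g * g') = 1 ∧ aeval M g' ∈ integerMatrices ι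

lemma exists_pow_isIntegerUnit {M : Matrix ι ι ℚ} {g g' : ℚ[X]} (hgg' : aeval M (g * g') = 1)
    (hg : IsIntegral ℤ (aeval M g)) (hg' : IsIntegral ℤ (aeval M g')) :
    ∃ k : ℕ, 0 < k ∧ IsIntegerUnit M (g ^ k) := by
  have : IsMulCommutative (Algebra.adjoin ℚ {M}) := Algebra.isMulCommutative_adjoin ℚ (by simp)
  let S : Subring (Algebra.adjoin ℚ {M}) :=
    (integerMatrices ι).comap (Algebra.adjoin ℚ {M}).val.toRingHom
  have hmem : ∀ g : ℚ[X], aeval M g ∈ Algebra.adjoin ℚ {M} := fun g =>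
    aeval_mem_adjoin_singleton _ _
  have hint : ∀ g : ℚ[X], IsIntegral ℤ (aeval M g) →
      IsIntegral ℤ (⟨aeval M g, hmem g⟩ : Algebra.adjoin ℚ {M}) := by
    intro g hg
    exact (isIntegral_algHom_iff ((Algebra.adjoin ℚ {M}).val.restrictScalars ℤ)
      Subtype.val_injective).1 hg
  obtain ⟨k, hk, h1, h2⟩ := exists_pow_mem_subring S (fun e => by
      obtain ⟨N, hN, h⟩ := exists_mul_mem_integerMatrices (e : Matrix ι ι ℚ)
      refine ⟨N, hN, ?_⟩
      change ((N : Algebra.adjoin ℚ {M}) * e : Algebra.adjoin ℚ {M}).1 ∈ integerMatrices ι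
      simpa using h)
    (u := ⟨aeval M g, hmem g⟩) (u' := ⟨aeval M g', hmem g'⟩)
    (Subtype.ext (by simpa using hgg')) (hint g hg) (hint g' hg')
  refine ⟨k, hk, ?_, g' ^ k, ?_, ?_⟩
  · rw [map_pow]; exact h1
  · rw [← mul_pow, map_pow, hgg', one_pow]
  · rw [map_pow]; exact h2

/-- The logarithms of the absolute values of the eigenvalues of `g(M)`. -/
noncomputable def logVector (M : Matrix ι ι ℚ) (g : ℚ[X]) : M.charpoly.rootSet ℂ → ℝ :=
  fun z => Real.log ‖aeval (z : ℂ) g‖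

/-- The embedding into `ℂ` of the field `ℚ[X]/(p)` attached to a root of `p`. -/
noncomputable def rootEmbedding (p : ℚ[X]) (z : ℂ) (hz : aeval z p = 0) :
    AdjoinRoot p →+* ℂ :=
  AdjoinRoot.lift (algebraMap ℚ ℂ) z hz

lemma rootEmbedding_mk (p : ℚ[X]) {z : ℂ} (hz : aeval z p = 0) (h : ℚ[X]) :
    rootEmbedding p z hz (AdjoinRoot.mk p h) = aeval z h :=
  AdjoinRoot.lift_mk _ _

lemma aeval_embedding_root (p : ℚ[X]) (φ : AdjoinRoot p →+* ℂ) (h : ℚ[X]) :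
    aeval (φ (AdjoinRoot.root p)) h = φ (AdjoinRoot.mk p h) := by
  rw [← AdjoinRoot.aeval_eq, aeval_def, aeval_def, hom_eval₂]
  congr 1
  exact RingHom.ext_rat _ _

lemma rootEmbedding_root (p : ℚ[X]) (φ : AdjoinRoot p →+* ℂ)
    (h : aeval (φ (AdjoinRoot.root p)) p = 0) :
    rootEmbedding p (φ (AdjoinRoot.root p)) h = φ := by
  refine RingHom.ext fun x => ?_
  obtain ⟨g, rfl⟩ := AdjoinRoot.mk_surjective x
  rw [rootEmbedding_mk, aeval_embedding_root]

/-- The eigenvalue at which an embedding of the field `ℚ[X]/(p)` of an irreducible factor `p`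
evaluates. -/
noncomputable def embeddingRoot {M : Matrix ι ι ℚ} {p : ℚ[X]} (hp : p ∈ factors M)
    (φ : AdjoinRoot p →+* ℂ) : M.charpoly.rootSet ℂ :=
  ⟨φ (AdjoinRoot.root p), mem_rootSet_of_factor hp (by
    rw [aeval_embedding_root, AdjoinRoot.mk_self, map_zero])⟩

lemma aeval_embeddingRoot {M : Matrix ι ι ℚ} {p : ℚ[X]} (hp : p ∈ factors M)
    (φ : AdjoinRoot p →+* ℂ) (h : ℚ[X]) :
    aeval (embeddingRoot hp φ : ℂ) h = φ (AdjoinRoot.mk p h) :=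
  aeval_embedding_root p φ h

lemma embeddingRoot_rootEmbedding {M : Matrix ι ι ℚ} {p : ℚ[X]} (hp : p ∈ factors M)
    (z : M.charpoly.rootSet ℂ) (hz : aeval (z : ℂ) p = 0) :
    embeddingRoot hp (rootEmbedding p z hz) = z := by
  apply Subtype.ext
  change rootEmbedding p z hz (AdjoinRoot.root p) = z
  rw [AdjoinRoot.root, rootEmbedding_mk, aeval_X]

lemma sum_embeddingRoot {M : Matrix ι ι ℚ} {p : ℚ[X]} (hp : p ∈ factors M)
    [Fact (Irreducible p)] (x : M.charpoly.rootSet ℂ → ℝ) :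
    ∑ φ, x (embeddingRoot hp φ) =
      ∑ z : M.charpoly.rootSet ℂ, if minpoly ℚ (z : ℂ) = p then x z else 0 := by
  classical
  have hroot : ∀ φ, aeval (embeddingRoot hp φ : ℂ) p = 0 := fun φ => by
    rw [aeval_embeddingRoot, AdjoinRoot.mk_self, map_zero]
  rw [← Finset.sum_filter]
  refine Finset.sum_bij (fun φ _ => embeddingRoot hp φ) (fun φ _ => ?_) (fun φ _ ψ _ h => ?_)
    (fun z hz => ?_) (fun φ _ => rfl)
  · exact Finset.mem_filter.2 ⟨Finset.mem_univ _, (minpoly_eq_iff hp).2 (hroot φ)⟩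
  · have h' : φ (AdjoinRoot.root p) = ψ (AdjoinRoot.root p) := congrArg Subtype.val h
    rw [← rootEmbedding_root p φ (hroot φ), ← rootEmbedding_root p ψ (hroot ψ)]
    congr 1
  · have hz' := (minpoly_eq_iff hp).1 (Finset.mem_filter.1 hz).2
    exact ⟨rootEmbedding p z hz', Finset.mem_univ _, embeddingRoot_rootEmbedding hp z hz'⟩

/-- A unit of the field attached to an irreducible factor `p`, extended by `1` to the other
factors, has a power that is an integer matrix together with its inverse. -/
lemma exists_isIntegerUnit_of_unit {M : Matrix ι ι ℚ} (hM : M.charpoly.Separable) {p : ℚ[X]}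
    (hp : p ∈ factors M) [Fact (Irreducible p)] (u : (NumberField.RingOfIntegers (AdjoinRoot p))ˣ) :
    ∃ (g : ℚ[X]) (k : ℕ), 0 < k ∧ IsIntegerUnit M (g ^ k) ∧
      (∀ z (hz : aeval z p = 0), aeval z g = rootEmbedding p z hz (u : AdjoinRoot p)) ∧
      ∀ z ∈ M.charpoly.rootSet ℂ, aeval z p ≠ 0 → aeval z g = 1 := by
  obtain ⟨q, hq, a, b, hab⟩ := exists_cofactor hM hp
  have hval : ∀ (x : AdjoinRoot p), ∃ g : ℚ[X],
      (∀ z (hz : aeval z p = 0), aeval z g = rootEmbedding p z hz x) ∧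
      ∀ z ∈ M.charpoly.rootSet ℂ, aeval z p ≠ 0 → aeval z g = 1 := by
    intro x
    obtain ⟨h, rfl⟩ := AdjoinRoot.mk_surjective x
    refine ⟨h * (b * q) + a * p, fun z hz => ?_, fun z hz hzp => ?_⟩
    · have := congrArg (aeval z) hab
      rw [map_add, map_mul _ a, hz, mul_zero, zero_add, map_one] at this
      rw [map_add, map_mul, this, map_mul, hz, mul_zero, add_zero, mul_one, rootEmbedding_mk]
    · have hzq : aeval z q = 0 := by
        have := (mem_rootSet'.1 hz).2
        rw [hq, map_mul] at this
        exact (mul_eq_zero.1 this).resolve_left hzp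
      have := congrArg (aeval z) hab
      rw [map_add, map_mul _ b, hzq, mul_zero, add_zero, map_one] at this
      rw [map_add, this, map_mul, map_mul _ b, hzq, mul_zero, mul_zero, zero_add]
  have hint : ∀ (x : NumberField.RingOfIntegers (AdjoinRoot p)) (g : ℚ[X]),
      (∀ z (hz : aeval z p = 0), aeval z g = rootEmbedding p z hz (x : AdjoinRoot p)) →
      (∀ z ∈ M.charpoly.rootSet ℂ, aeval z p ≠ 0 → aeval z g = 1) →
      IsIntegral ℤ (aeval M g) := by
    intro x g h1 h2
    obtain ⟨P, hP, hPx⟩ := x.isIntegral_coe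
    refine isIntegral_aeval_of_roots hM (hP.mul (monic_X_sub_C 1)) fun z hz => ?_
    rw [map_mul, map_sub, aeval_X, aeval_C]
    by_cases hzp : aeval z p = 0
    · have : aeval (aeval z g) P = 0 := by
        rw [h1 z hzp, aeval_def, RingHom.ext_int (algebraMap ℤ ℂ)
          ((rootEmbedding p z hzp).comp (algebraMap ℤ (AdjoinRoot p))), ← hom_eval₂]
        exact (congrArg _ hPx).trans (map_zero _)
      rw [this, zero_mul]
    · rw [h2 z hz hzp]; simp
  obtain ⟨g, hg1, hg2⟩ := hval (u : AdjoinRoot p)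
  obtain ⟨g', hg1', hg2'⟩ := hval ((u⁻¹ : _ˣ) : AdjoinRoot p)
  have hgg' : aeval M (g * g') = 1 := by
    rw [← map_one (aeval (R := ℚ) M), aeval_eq_iff hM]
    intro z hz
    by_cases hzp : aeval z p = 0
    · have hu : (u : AdjoinRoot p) * ((u⁻¹ : _ˣ) : AdjoinRoot p) = 1 := by
        rw [← map_mul, u.mul_inv, map_one]
      rw [map_mul, hg1 z hzp, hg1' z hzp, ← map_mul, hu, map_one, map_one]
    · rw [map_mul, hg2 z hz hzp, hg2' z hz hzp, map_one, one_mul]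
  obtain ⟨k, hk, hk'⟩ := exists_pow_isIntegerUnit hgg' (hint _ g hg1 hg2) (hint _ g' hg1' hg2')
  exact ⟨g, k, hk, hk', hg1, hg2⟩

/-- Dirichlet's unit theorem for the order `ℚ[M] ∩ Mₙ(ℤ)`. -/
lemma mem_span_logVector {M : Matrix ι ι ℚ} (hM : M.charpoly.Separable)
    {x : M.charpoly.rootSet ℂ → ℝ}
    (hconj : ∀ z w : M.charpoly.rootSet ℂ, (w : ℂ) = (starRingEnd ℂ) z → x w = x z)
    (hsum : ∀ p ∈ factors M,
      ∑ z : M.charpoly.rootSet ℂ, (if minpoly ℚ (z : ℂ) = p then x z else 0) = 0) :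
    x ∈ Submodule.span ℝ (logVector M '' {g | IsIntegerUnit M g}) := by
  classical
  have hx : x = ∑ p ∈ factors M, fun z : M.charpoly.rootSet ℂ =>
      if minpoly ℚ (z : ℂ) = p then x z else 0 := by
    funext z
    rw [Finset.sum_apply, Finset.sum_ite_eq, if_pos (mem_factors.2 ⟨z, z.2, rfl⟩)]
  rw [hx]
  refine Submodule.sum_mem _ fun p hp => ?_
  have : Fact (Irreducible p) := ⟨irreducible_of_mem_factors hp⟩
  let T : ((AdjoinRoot p →+* ℂ) → ℝ) →ₗ[ℝ] (M.charpoly.rootSet ℂ → ℝ) :=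
    { toFun := fun y z => if hz : aeval (z : ℂ) p = 0 then y (rootEmbedding p z hz) else 0
      map_add' := fun y y' => by
        funext z; by_cases hz : aeval (z : ℂ) p = 0 <;> simp [hz]
      map_smul' := fun c y => by
        funext z; by_cases hz : aeval (z : ℂ) p = 0 <;> simp [hz] }
  have hT : (fun z : M.charpoly.rootSet ℂ => if minpoly ℚ (z : ℂ) = p then x z else 0) =
      T (fun φ => x (embeddingRoot hp φ)) := by
    funext z
    by_cases hz : aeval (z : ℂ) p = 0
    · simp only [(minpoly_eq_iff hp).2 hz, if_true, T, LinearMap.coe_mk, AddHom.coe_mk, hz,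
        dite_true, embeddingRoot_rootEmbedding hp z hz]
    · simp only [mt (minpoly_eq_iff hp).1 hz, if_false, T, LinearMap.coe_mk, AddHom.coe_mk, hz,
        dite_false]
  rw [hT]
  have hspan := mem_span_log_units (K := AdjoinRoot p) (x := fun φ => x (embeddingRoot hp φ))
    (fun φ => hconj _ _ rfl) ((sum_embeddingRoot hp x).trans (hsum p hp))
  have h2 := Submodule.mem_map_of_mem (f := T) hspan
  rw [Submodule.map_span] at h2
  refine Submodule.span_le.2 ?_ h2
  rintro _ ⟨_, ⟨u, rfl⟩, rfl⟩
  obtain ⟨g, k, hk, hgk, hg1, hg2⟩ := exists_isIntegerUnit_of_unit hM hp u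
  have : T (fun φ => Real.log ‖φ (u : AdjoinRoot p)‖) = (k : ℝ)⁻¹ • logVector M (g ^ k) := by
    funext z
    have hk' : (k : ℝ) ≠ 0 := by exact_mod_cast hk.ne'
    simp only [T, LinearMap.coe_mk, AddHom.coe_mk, Pi.smul_apply, logVector, map_pow, norm_pow,
      Real.log_pow, smul_eq_mul, inv_mul_cancel_left₀ hk']
    by_cases hz : aeval (z : ℂ) p = 0
    · rw [dif_pos hz, hg1 z hz]
    · rw [dif_neg hz, hg2 z z.2 hz, norm_one, Real.log_one]
  rw [SetLike.mem_coe, this]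
  exact Submodule.smul_mem _ _ (Submodule.subset_span ⟨_, hgk, rfl⟩)

end IntegralUnits

/-! ### The dimension of the log space -/

section LogSpace

variable {ι : Type*} [Fintype ι] [DecidableEq ι]

/-- The conjugation-invariant real functions `x` on the eigenvalues with `x(z⁻¹) = -x(z)`. -/
def antiInvariantSpace (M : Matrix ι ι ℚ) : Submodule ℝ (M.charpoly.rootSet ℂ → ℝ) where
  carrier := {x | (∀ z w : M.charpoly.rootSet ℂ, (w : ℂ) = (starRingEnd ℂ) z → x w = x z) ∧
    ∀ z w : M.charpoly.rootSet ℂ, (w : ℂ) = (z : ℂ)⁻¹ → x w = -x z}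
  add_mem' := fun {x y} hx hy => ⟨fun z w h => by simp [hx.1 z w h, hy.1 z w h],
    fun z w h => by simp [hx.2 z w h, hy.2 z w h, add_comm]⟩
  zero_mem' := by simp
  smul_mem' := fun c x hx => ⟨fun z w h => by simp [hx.1 z w h],
    fun z w h => by simp [hx.2 z w h]⟩

/-- The sum of a function over the roots of an irreducible factor `p`. -/
noncomputable def classSum (M : Matrix ι ι ℚ) (p : ℚ[X]) :
    (M.charpoly.rootSet ℂ → ℝ) →ₗ[ℝ] ℝ where
  toFun x := ∑ z : M.charpoly.rootSet ℂ, if minpoly ℚ (z : ℂ) = p then x z else 0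
  map_add' x y := by
    rw [← Finset.sum_add_distrib]
    exact Finset.sum_congr rfl fun z _ => by split_ifs <;> simp
  map_smul' c x := by
    rw [RingHom.id_apply, smul_eq_mul, Finset.mul_sum]
    exact Finset.sum_congr rfl fun z _ => by split_ifs <;> simp

lemma classSum_apply (M : Matrix ι ι ℚ) (p : ℚ[X]) (x : M.charpoly.rootSet ℂ → ℝ) :
    classSum M p x = ∑ z : M.charpoly.rootSet ℂ, if minpoly ℚ (z : ℂ) = p then x z else 0 := rfl

/-- The anti-invariant functions whose sum over the roots of each irreducible factor vanishes.
It is the real span of the logarithmic vectors of the centralizer, see `span_range_logMap`. -/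
noncomputable def unitLogSpace (M : Matrix ι ι ℚ) : Submodule ℝ (M.charpoly.rootSet ℂ → ℝ) :=
  antiInvariantSpace M ⊓ ⨅ p ∈ factors M, LinearMap.ker (classSum M p)

lemma mem_unitLogSpace {M : Matrix ι ι ℚ} {x : M.charpoly.rootSet ℂ → ℝ} :
    x ∈ unitLogSpace M ↔ x ∈ antiInvariantSpace M ∧ ∀ p ∈ factors M, classSum M p x = 0 := by
  simp [unitLogSpace]

/-- The eigenvalues outside the unit circle in the closed upper half plane. -/
def outerEigenvalues (M : Matrix ι ι ℚ) : Set (M.charpoly.rootSet ℂ) :=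
  {z | 1 < ‖(z : ℂ)‖ ∧ 0 ≤ (z : ℂ).im}

/-- The eigenvalues are nonzero and closed under inversion. -/
def IsReciprocal (M : Matrix ι ι ℚ) : Prop :=
  ∀ z ∈ M.charpoly.rootSet ℂ, z ≠ 0 ∧ z⁻¹ ∈ M.charpoly.rootSet ℂ

lemma antiInvariant_eq_zero {M : Matrix ι ι ℚ} (hR : IsReciprocal M)
    {x : M.charpoly.rootSet ℂ → ℝ} (hx : x ∈ antiInvariantSpace M)
    (h0 : ∀ z ∈ outerEigenvalues M, x z = 0) : x = 0 := by
  have hbig : ∀ z : M.charpoly.rootSet ℂ, 1 < ‖(z : ℂ)‖ → x z = 0 := by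
    intro z hz
    rcases le_total 0 (z : ℂ).im with him | him
    · exact h0 z ⟨hz, him⟩
    · rw [← hx.1 z ⟨_, conj_mem_rootSet z.2⟩ rfl]
      exact h0 _ ⟨by simpa using hz, by simpa using him⟩
  funext z
  rcases lt_trichotomy 1 ‖(z : ℂ)‖ with hz | hz | hz
  · exact hbig z hz
  · -- on the unit circle conjugation and inversion agree
    have h1 := hx.1 z ⟨_, conj_mem_rootSet z.2⟩ rfl
    have h2 := hx.2 z ⟨_, conj_mem_rootSet z.2⟩ (by
      rw [Complex.inv_def, Complex.normSq_eq_norm_sq, ← hz]; simp)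
    rw [Pi.zero_apply]
    linarith
  · have h2 := hx.2 z ⟨_, (hR z z.2).2⟩ rfl
    rw [hbig] at h2
    · simpa using h2.symm
    · rw [norm_inv]
      exact (one_lt_inv₀ (norm_pos_iff.2 (hR z z.2).1)).2 hz

/-- The representative in the closed upper half plane of a complex number up to conjugation. -/
noncomputable def upperRep (z : ℂ) : ℂ := open Classical in
  if 0 ≤ z.im then z else (starRingEnd ℂ) z

lemma upperRep_conj (z : ℂ) : upperRep ((starRingEnd ℂ) z) = upperRep z := by
  rcases lt_trichotomy z.im 0 with h | h | h
  · simp [upperRep, h.le, not_le.2 h]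
  · simp [upperRep, h, Complex.conj_eq_iff_im.2 h]
  · simp [upperRep, h.le, not_le.2 h]

lemma exists_antiInvariant_extension {M : Matrix ι ι ℚ}
    (y : outerEigenvalues M → ℝ) : ∃ x ∈ antiInvariantSpace M, ∀ z, x z.1 = y z := by
  classical
  let t : ℂ → ℝ := fun z =>
    if h : ∃ h : z ∈ M.charpoly.rootSet ℂ, ⟨z, h⟩ ∈ outerEigenvalues M then y ⟨⟨z, h.1⟩, h.2⟩ else 0
  let Y : ℂ → ℝ := fun z => if 1 < ‖z‖ then t (upperRep z) else 0
  have hY : ∀ z, Y ((starRingEnd ℂ) z) = Y z := fun z => by simp [Y, upperRep_conj]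
  refine ⟨fun z => Y z - Y (z : ℂ)⁻¹, ⟨fun z w h => ?_, fun z w h => ?_⟩, fun z => ?_⟩
  · change Y w - Y (w : ℂ)⁻¹ = Y z - Y (z : ℂ)⁻¹
    rw [h, ← map_inv₀, hY, hY]
  · change Y w - Y (w : ℂ)⁻¹ = -(Y z - Y (z : ℂ)⁻¹)
    rw [h, inv_inv]; ring
  · have h1 : 1 < ‖(z.1 : ℂ)‖ := z.2.1
    have h2 : ¬ 1 < ‖(z.1 : ℂ)⁻¹‖ := by
      rw [norm_inv, not_lt]
      exact inv_le_one_of_one_le₀ h1.le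
    have h3 : upperRep (z.1 : ℂ) = z.1 := if_pos z.2.2
    have h4 : t (z.1 : ℂ) = y z := dif_pos ⟨z.1.2, z.2⟩
    simp only [Y, if_pos h1, if_neg h2, h3, h4, sub_zero]

lemma finrank_antiInvariantSpace {M : Matrix ι ι ℚ} (hR : IsReciprocal M) :
    Module.finrank ℝ (antiInvariantSpace M) = (outerEigenvalues M).ncard := by
  classical
  let L : antiInvariantSpace M →ₗ[ℝ] (outerEigenvalues M → ℝ) :=
    (LinearMap.funLeft ℝ ℝ (Subtype.val : outerEigenvalues M → _)).comp
      (antiInvariantSpace M).subtype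
  have hL : Function.Bijective L := by
    constructor
    · rw [← LinearMap.ker_eq_bot, LinearMap.ker_eq_bot']
      intro x hx
      exact Subtype.ext (antiInvariant_eq_zero hR x.2 fun z hz => congrFun hx ⟨z, hz⟩)
    · intro y
      obtain ⟨x, hx, h⟩ := exists_antiInvariant_extension y
      exact ⟨⟨x, hx⟩, funext h⟩
  rw [(LinearEquiv.ofBijective L hL).finrank_eq, Module.finrank_fintype_fun_eq_card,
    ← Nat.card_eq_fintype_card, Nat.card_coe_set_eq]

/-- An involution without fixed points splits a finite set into two halves. -/
lemma exists_half_of_involution {α : Type*} (N : Finset α) (δ : α → α)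
    (hδN : ∀ p ∈ N, δ p ∈ N) (hδδ : ∀ p ∈ N, δ (δ p) = p) (hne : ∀ p ∈ N, δ p ≠ p) :
    ∃ S ⊆ N, N.card = 2 * S.card ∧ ∀ p ∈ N, p ∈ S ↔ δ p ∉ S := by
  classical
  let : LinearOrder α := linearOrderOfSTO WellOrderingRel
  have hiff : ∀ p ∈ N, p ∈ N.filter (fun p => p < δ p) ↔ δ p ∉ N.filter (fun p => p < δ p) := by
    intro p hp
    simp only [Finset.mem_filter, hp, hδN p hp, hδδ p hp, true_and, not_lt]
    exact ⟨le_of_lt, fun h => lt_of_le_of_ne h (hne p hp).symm⟩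
  refine ⟨N.filter fun p => p < δ p, Finset.filter_subset _ _, ?_, hiff⟩
  rw [← Finset.card_filter_add_card_filter_not (s := N) (fun p => p < δ p), two_mul]
  congr 1
  refine (Finset.card_bij (fun p _ => δ p) ?_ ?_ ?_).symm
  · intro p hp
    have hpN := (Finset.mem_filter.1 hp).1
    rw [Finset.mem_filter]
    exact ⟨hδN p hpN, fun h => (hiff p hpN).1 hp (Finset.mem_filter.2 ⟨hδN p hpN, h⟩)⟩
  · intro p hp q hq h
    rw [← hδδ p (Finset.mem_filter.1 hp).1, h, hδδ q (Finset.mem_filter.1 hq).1]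
  · intro p hp
    obtain ⟨hpN, hp⟩ := Finset.mem_filter.1 hp
    refine ⟨δ p, Finset.mem_filter.2 ⟨hδN p hpN, ?_⟩, hδδ p hpN⟩
    rw [hδδ p hpN]
    exact lt_of_le_of_ne (not_lt.1 hp) (hne p hpN)

end LogSpace

section DualFactors

variable {l : Type*} [Fintype l] [DecidableEq l] {M : Matrix (l ⊕ l) (l ⊕ l) ℚ}

lemma isReciprocal_of_symplectic (hM : M.charpoly.Separable)
    (hS : M ∈ Matrix.symplecticGroup l ℚ) : IsReciprocal M :=
  fun _ hz => ⟨root_ne_zero hM hS hz, inv_mem_rootSet hM hS hz⟩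

lemma minpoly_inv_congr (hM : M.charpoly.Separable) (hS : M ∈ Matrix.symplecticGroup l ℚ)
    {z w : ℂ} (hz : z ∈ M.charpoly.rootSet ℂ) (hw : w ∈ M.charpoly.rootSet ℂ)
    (h : minpoly ℚ z = minpoly ℚ w) : minpoly ℚ z⁻¹ = minpoly ℚ w⁻¹ := by
  have hr : minpoly ℚ z⁻¹ ∈ factors M := mem_factors.2 ⟨_, inv_mem_rootSet hM hS hz, rfl⟩
  symm
  rw [minpoly_eq_iff hr, ← aeval_root_comp_adjointPoly hM hS _ hw]
  refine aeval_eq_zero_of_dvd_aeval_eq_zero (p := minpoly ℚ w) ?_ (minpoly.aeval _ _)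
  rw [← h]
  apply minpoly.dvd
  rw [aeval_root_comp_adjointPoly hM hS _ hz, minpoly.aeval]

/-- The irreducible factor whose roots are the inverses of the roots of `p`. -/
noncomputable def dualFactor (M : Matrix (l ⊕ l) (l ⊕ l) ℚ) (p : ℚ[X]) : ℚ[X] :=
  open Classical in
  if h : ∃ z ∈ M.charpoly.rootSet ℂ, minpoly ℚ z = p then minpoly ℚ h.choose⁻¹ else p

lemma dualFactor_minpoly (hM : M.charpoly.Separable) (hS : M ∈ Matrix.symplecticGroup l ℚ)
    {z : ℂ} (hz : z ∈ M.charpoly.rootSet ℂ) :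
    dualFactor M (minpoly ℚ z) = minpoly ℚ z⁻¹ := by
  have h : ∃ w ∈ M.charpoly.rootSet ℂ, minpoly ℚ w = minpoly ℚ z := ⟨z, hz, rfl⟩
  rw [dualFactor, dif_pos h]
  exact minpoly_inv_congr hM hS h.choose_spec.1 hz h.choose_spec.2

lemma dualFactor_mem (hM : M.charpoly.Separable) (hS : M ∈ Matrix.symplecticGroup l ℚ)
    {p : ℚ[X]} (hp : p ∈ factors M) : dualFactor M p ∈ factors M := by
  obtain ⟨z, hz, rfl⟩ := mem_factors.1 hp
  rw [dualFactor_minpoly hM hS hz]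
  exact mem_factors.2 ⟨_, inv_mem_rootSet hM hS hz, rfl⟩

lemma dualFactor_dualFactor (hM : M.charpoly.Separable) (hS : M ∈ Matrix.symplecticGroup l ℚ)
    {p : ℚ[X]} (hp : p ∈ factors M) : dualFactor M (dualFactor M p) = p := by
  obtain ⟨z, hz, rfl⟩ := mem_factors.1 hp
  rw [dualFactor_minpoly hM hS hz, dualFactor_minpoly hM hS (inv_mem_rootSet hM hS hz), inv_inv]

/-- The irreducible factors `p` that differ from their dual. -/
noncomputable def nonSelfDualFactors (M : Matrix (l ⊕ l) (l ⊕ l) ℚ) : Finset ℚ[X] :=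
  open Classical in
  (factors M).filter fun p => dualFactor M p ≠ p

lemma classSum_dualFactor (hM : M.charpoly.Separable) (hS : M ∈ Matrix.symplecticGroup l ℚ)
    {p : ℚ[X]} (hp : p ∈ factors M) {x : M.charpoly.rootSet ℂ → ℝ}
    (hx : x ∈ antiInvariantSpace M) : classSum M (dualFactor M p) x = -classSum M p x := by
  classical
  rw [classSum_apply, classSum_apply, ← Finset.sum_neg_distrib]
  let e : M.charpoly.rootSet ℂ ≃ M.charpoly.rootSet ℂ :=
    { toFun := fun z => ⟨_, inv_mem_rootSet hM hS z.2⟩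
      invFun := fun z => ⟨_, inv_mem_rootSet hM hS z.2⟩
      left_inv := fun z => Subtype.ext (inv_inv _)
      right_inv := fun z => Subtype.ext (inv_inv _) }
  refine (Fintype.sum_equiv e _ _ fun z => ?_).symm
  have hiff : minpoly ℚ (e z : ℂ) = dualFactor M p ↔ minpoly ℚ (z : ℂ) = p := by
    change minpoly ℚ (z : ℂ)⁻¹ = _ ↔ _
    rw [← dualFactor_minpoly hM hS z.2]
    refine ⟨fun h => ?_, fun h => by rw [h]⟩
    rw [← dualFactor_dualFactor hM hS hp, ← h,
      dualFactor_dualFactor hM hS (mem_factors.2 ⟨_, z.2, rfl⟩)]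
  by_cases h : minpoly ℚ (z : ℂ) = p
  · rw [if_pos h, if_pos (hiff.2 h), hx.2 z (e z) rfl]
  · rw [if_neg h, if_neg (mt hiff.1 h), neg_zero]

lemma minpoly_conj (z : ℂ) : minpoly ℚ ((starRingEnd ℂ) z) = minpoly ℚ z :=
  minpoly.algHom_eq (Complex.conjAe.toAlgHom.restrictScalars ℚ) (RingHom.injective _) z

/-- A function supported on a non-self-dual factor and its dual with prescribed class sum. -/
lemma exists_antiInvariant_classSum (hM : M.charpoly.Separable)
    (hS : M ∈ Matrix.symplecticGroup l ℚ) {p : ℚ[X]} (hp : p ∈ nonSelfDualFactors M) :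
    ∃ x ∈ antiInvariantSpace M, classSum M p x = 1 ∧
      ∀ p', p' ≠ p → p' ≠ dualFactor M p → classSum M p' x = 0 := by
  classical
  obtain ⟨hpF, hpd⟩ := Finset.mem_filter.1 hp
  obtain ⟨z, hz, rfl⟩ := mem_factors.1 hpF
  rw [dualFactor_minpoly hM hS hz] at hpd ⊢
  let y : ℂ → ℝ := fun w =>
    (if w = z then 1 / 2 else 0) + (if (starRingEnd ℂ) w = z then 1 / 2 else 0)
  have hyz : ∀ w, minpoly ℚ w ≠ minpoly ℚ z → y w = 0 := by
    intro w hw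
    have h1 : w ≠ z := fun h => hw (by rw [h])
    have h2 : (starRingEnd ℂ) w ≠ z := fun h => hw (by rw [← h, minpoly_conj])
    simp [y, h1, h2]
  have hyinv : ∀ w ∈ M.charpoly.rootSet ℂ, minpoly ℚ w ≠ minpoly ℚ z⁻¹ → y w⁻¹ = 0 := by
    intro w hw hne
    refine hyz _ fun h => hne ?_
    rw [← minpoly_inv_congr hM hS (inv_mem_rootSet hM hS hw) hz h, inv_inv]
  have hyc : ∀ w, y ((starRingEnd ℂ) w) = y w := fun w => by
    simp only [y, Complex.conj_conj]; rw [add_comm]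
  refine ⟨fun w => y w - y (w : ℂ)⁻¹, ⟨fun v w h => ?_, fun v w h => ?_⟩, ?_, fun p' h1 h2 => ?_⟩
  · change y w - y (w : ℂ)⁻¹ = y v - y (v : ℂ)⁻¹
    rw [h, ← map_inv₀, hyc, hyc]
  · change y w - y (w : ℂ)⁻¹ = -(y v - y (v : ℂ)⁻¹)
    rw [h, inv_inv]; ring
  · rw [classSum_apply]
    have : ∀ w : M.charpoly.rootSet ℂ,
        (if minpoly ℚ (w : ℂ) = minpoly ℚ z then y w - y (w : ℂ)⁻¹ else 0) =
        (if w = ⟨z, hz⟩ then 1 / 2 else 0) +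
          (if w = ⟨_, conj_mem_rootSet hz⟩ then 1 / 2 else 0) := by
      intro w
      have e1 : w = ⟨z, hz⟩ ↔ (w : ℂ) = z := Subtype.ext_iff
      have e2 : w = ⟨_, conj_mem_rootSet hz⟩ ↔ (starRingEnd ℂ) (w : ℂ) = z := by
        rw [Subtype.ext_iff]
        exact ⟨fun h => by rw [h, Complex.conj_conj],
          fun h => by simp only [← h, Complex.conj_conj]⟩
      simp only [e1, e2]
      by_cases h : minpoly ℚ (w : ℂ) = minpoly ℚ z
      · rw [if_pos h, hyinv w w.2 (by rw [h]; exact hpd.symm), sub_zero]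
      · rw [if_neg h]
        exact (hyz w h).symm
    rw [Finset.sum_congr rfl fun w _ => this w, Finset.sum_add_distrib, Finset.sum_ite_eq',
      Finset.sum_ite_eq']
    norm_num
  · rw [classSum_apply]
    refine Finset.sum_eq_zero fun w _ => ?_
    by_cases h : minpoly ℚ (w : ℂ) = p'
    · rw [if_pos h, hyz _ (by rw [h]; exact h1), hyinv w w.2 (by rw [h]; exact h2), sub_zero]
    · rw [if_neg h]

/-- The dimension formula for the span of the symplectic units: the class sums of a pair of dual
factors impose one condition, those of self-dual factors vanish automatically. -/
lemma exists_finrank_unitLogSpace (hM : M.charpoly.Separable)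
    (hS : M ∈ Matrix.symplecticGroup l ℚ) :
    ∃ I : ℕ, (nonSelfDualFactors M).card = 2 * I ∧
      Module.finrank ℝ (unitLogSpace M) + I = (outerEigenvalues M).ncard := by
  classical
  have hN : ∀ p ∈ nonSelfDualFactors M, p ∈ factors M ∧ dualFactor M p ≠ p := fun p hp =>
    (Finset.mem_filter (p := fun p => dualFactor M p ≠ p)).1 hp
  obtain ⟨S, hSN, hcard, hiff⟩ := exists_half_of_involution (nonSelfDualFactors M) (dualFactor M)
    (fun p hp => Finset.mem_filter.2 ⟨dualFactor_mem hM hS (hN p hp).1, by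
      rw [dualFactor_dualFactor hM hS (hN p hp).1]; exact (hN p hp).2.symm⟩)
    (fun p hp => dualFactor_dualFactor hM hS (hN p hp).1) (fun p hp => (hN p hp).2)
  refine ⟨S.card, hcard, ?_⟩
  let L : antiInvariantSpace M →ₗ[ℝ] (S → ℝ) :=
    LinearMap.pi fun p => (classSum M p.1).comp (antiInvariantSpace M).subtype
  have hsurj : Function.Surjective L := by
    rw [← LinearMap.range_eq_top, eq_top_iff, ← (Pi.basisFun ℝ S).span_eq, Submodule.span_le]
    rintro _ ⟨p, rfl⟩
    obtain ⟨x, hx, h1, h2⟩ := exists_antiInvariant_classSum hM hS (hSN p.2)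
    refine ⟨⟨x, hx⟩, ?_⟩
    funext q
    change classSum M q.1 x = _
    rw [Pi.basisFun_apply]
    rcases eq_or_ne q p with rfl | hqp
    · rw [h1, Pi.single_eq_same]
    · rw [Pi.single_eq_of_ne hqp]
      refine h2 _ (fun h => hqp (Subtype.ext h)) fun h => ?_
      exact (hiff p (hSN p.2)).1 p.2 (h ▸ q.2)
  have hker : (LinearMap.ker L).map (antiInvariantSpace M).subtype = unitLogSpace M := by
    ext x
    rw [mem_unitLogSpace, Submodule.mem_map]
    constructor
    · rintro ⟨y, hy, rfl⟩
      refine ⟨y.2, fun p hp => ?_⟩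
      have hSzero : ∀ q ∈ S, classSum M q y = 0 := fun q hq => congrFun hy ⟨q, hq⟩
      by_cases hself : dualFactor M p = p
      · have := classSum_dualFactor hM hS hp y.2
        rw [hself] at this
        exact self_eq_neg.1 this
      · have hpN : p ∈ nonSelfDualFactors M := Finset.mem_filter.2 ⟨hp, hself⟩
        by_cases hpS : p ∈ S
        · exact hSzero p hpS
        · have := hSzero _ (not_not.1 (mt (hiff p hpN).2 hpS))
          rw [classSum_dualFactor hM hS hp y.2] at this
          exact neg_eq_zero.1 this
    · rintro ⟨hx, h⟩
      exact ⟨⟨x, hx⟩, funext fun q => h q.1 (hN _ (hSN q.2)).1, rfl⟩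
  have h1 := LinearMap.finrank_range_add_finrank_ker L
  rw [LinearMap.range_eq_top.2 hsurj, finrank_top, Module.finrank_fintype_fun_eq_card,
    finrank_antiInvariantSpace (isReciprocal_of_symplectic hM hS), Fintype.card_coe] at h1
  rw [← hker, Submodule.finrank_map_subtype_eq, ← h1, add_comm]

end DualFactors

/-! ### Lattices, and the number of eigenvalues of each kind -/

section Lattices

/-- A commutative group with a homomorphism to a real vector space, whose image spans and that
maps only finitely many elements to each ball, is the product of a finite group and a free
abelian group whose rank is the dimension. -/
lemma exists_mulEquiv_of_log {G V : Type*} [CommGroup G] [NormedAddCommGroup V]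
    [NormedSpace ℝ V] [FiniteDimensional ℝ V] (L : Additive G →+ V)
    (hfin : ∀ r : ℝ, {g : G | ‖L (Additive.ofMul g)‖ ≤ r}.Finite)
    (hspan : Submodule.span ℝ (Set.range L) = ⊤) :
    ∃ N : Subgroup G, Finite N ∧
      Nonempty (G ≃* N × Multiplicative (Fin (Module.finrank ℝ V) → ℤ)) := by
  let Λ : Submodule ℤ V := LinearMap.range L.toIntLinearMap
  have hdisc : DiscreteTopology Λ := by
    refine discreteTopology_of_isOpen_singleton_zero ?_
    refine isOpen_singleton_of_finite_mem_nhds 0 (s := Metric.closedBall 0 1) ?_ ?_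
    · exact Metric.closedBall_mem_nhds _ zero_lt_one
    · refine Set.Finite.of_finite_image ?_ (Subtype.val_injective.injOn)
      refine ((hfin 1).image fun g => L (Additive.ofMul g)).subset ?_
      rintro _ ⟨⟨_, ⟨g, rfl⟩⟩, hx, rfl⟩
      exact ⟨g.toMul, by simpa using hx, rfl⟩
  have hlat : IsZLattice ℝ Λ := ⟨by
    rw [← hspan]
    congr 1⟩
  have hfree : Module.Free ℤ Λ := ZLattice.module_free ℝ Λ
  have hfinite : Module.Finite ℤ Λ := ZLattice.module_finite ℝ Λ
  let b : Module.Basis (Fin (Module.finrank ℝ V)) ℤ Λ :=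
    Module.finBasisOfFinrankEq ℤ Λ (ZLattice.rank ℝ Λ)
  let L' : Additive G →ₗ[ℤ] Λ := L.toIntLinearMap.rangeRestrict
  obtain ⟨s, hs⟩ := Module.projective_lifting_property L' LinearMap.id
    (LinearMap.surjective_rangeRestrict _)
  have hs' : ∀ y, L' (s y) = y := fun y => LinearMap.congr_fun hs y
  let N : Subgroup G := (LinearMap.ker L').toAddSubgroup.toSubgroup'
  have hN : ∀ g : G, g ∈ N ↔ L' (Additive.ofMul g) = 0 := fun g => Iff.rfl
  refine ⟨N, ?_, ⟨MulEquiv.symm (MulEquiv.ofBijective (MonoidHom.mk' (fun x :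
    N × Multiplicative (Fin (Module.finrank ℝ V) → ℤ) =>
      (x.1 : G) * (s (b.equivFun.symm x.2.toAdd)).toMul) ?_) ?_)⟩⟩
  · refine ((hfin 0).subset fun g hg => ?_).to_subtype
    have h0 : L (Additive.ofMul g) = 0 := congrArg Subtype.val ((hN g).1 hg)
    simp [h0]
  · rintro ⟨n, t⟩ ⟨n', t'⟩
    simp only [Prod.mk_mul_mk, Subgroup.coe_mul, toAdd_mul, map_add]
    exact mul_mul_mul_comm _ _ _ _
  · constructor
    · rw [injective_iff_map_eq_one]
      rintro ⟨n, t⟩ h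
      change (n : G) * (s (b.equivFun.symm t.toAdd)).toMul = 1 at h
      have h1 : L' (Additive.ofMul (n : G)) + b.equivFun.symm t.toAdd = 0 := by
        rw [← hs' (b.equivFun.symm t.toAdd), ← map_add]
        exact (congrArg (fun g => L' (Additive.ofMul g)) h).trans (map_zero L')
      rw [(hN n).1 n.2, zero_add, LinearEquiv.map_eq_zero_iff] at h1
      have ht : t = 1 := h1
      rw [h1, map_zero, map_zero] at h
      have hn : n = 1 := Subtype.ext (by simpa using h)
      rw [ht, hn]; rfl
    · intro g
      refine ⟨(⟨g * ((s (L' (Additive.ofMul g))).toMul)⁻¹, ?_⟩,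
        Multiplicative.ofAdd (b.equivFun (L' (Additive.ofMul g)))), ?_⟩
      · rw [hN, ofMul_mul, ofMul_inv, ofMul_toMul, map_add, map_neg, hs', add_neg_cancel]
      · change g * ((s (L' (Additive.ofMul g))).toMul)⁻¹ *
          (s (b.equivFun.symm (b.equivFun (L' (Additive.ofMul g))))).toMul = g
        rw [LinearEquiv.symm_apply_apply, inv_mul_cancel_right]

end Lattices

section EigenvalueCounts

/-- Two conditions interchanged by an involution of a finite set hold equally often. -/
lemma card_filter_eq_of_involution {α : Type*} (R : Finset α) (e : α → α) {P Q : α → Prop}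
    [DecidablePred P] [DecidablePred Q] (he : ∀ z ∈ R, e z ∈ R) (hee : ∀ z ∈ R, e (e z) = z)
    (hPQ : ∀ z ∈ R, P z → Q (e z)) (hQP : ∀ z ∈ R, Q z → P (e z)) :
    (R.filter P).card = (R.filter Q).card := by
  refine Finset.card_nbij' e e ?_ ?_ ?_ ?_
  · intro z hz
    simp only [Finset.coe_filter, Set.mem_ofPred_eq] at hz ⊢
    exact ⟨he z hz.1, hPQ z hz.1 hz.2⟩
  · intro z hz
    simp only [Finset.coe_filter, Set.mem_ofPred_eq] at hz ⊢
    exact ⟨he z hz.1, hQP z hz.1 hz.2⟩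
  · intro z hz
    exact hee z (Finset.mem_filter.1 hz).1
  · intro z hz
    exact hee z (Finset.mem_filter.1 hz).1

lemma one_lt_norm_inv_iff {z : ℂ} (hz : z ≠ 0) : 1 < ‖z⁻¹‖ ↔ ‖z‖ < 1 := by
  rw [norm_inv]
  exact one_lt_inv₀ (norm_pos_iff.2 hz)

lemma norm_inv_lt_one_iff {z : ℂ} (hz : z ≠ 0) : ‖z⁻¹‖ < 1 ↔ 1 < ‖z‖ := by
  rw [← one_lt_norm_inv_iff (inv_ne_zero hz), inv_inv]

lemma im_inv_eq_zero_iff {z : ℂ} (hz : z ≠ 0) : z⁻¹.im = 0 ↔ z.im = 0 := by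
  rw [Complex.inv_im, div_eq_zero_iff, neg_eq_zero, Complex.normSq_eq_zero, or_iff_left hz]

variable {R : Finset ℂ}

open Classical in
lemma card_real_eq (h0 : ∀ z ∈ R, z ≠ 0) (hinv : ∀ z ∈ R, z⁻¹ ∈ R) (hne : ∀ z ∈ R, z⁻¹ ≠ z) :
    (R.filter fun z => z.im = 0).card = 2 * (R.filter fun z => z.im = 0 ∧ 1 < ‖z‖).card := by
  rw [← Finset.card_filter_add_card_filter_not (s := R.filter fun z => z.im = 0)
    (fun z => 1 < ‖z‖), Finset.filter_filter, Finset.filter_filter, two_mul]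
  congr 1
  have : ∀ z ∈ R, z.im = 0 → ‖z‖ ≠ 1 := by
    intro z hz him h1
    refine hne z hz ?_
    rw [Complex.inv_def, Complex.normSq_eq_norm_sq, h1, Complex.conj_eq_iff_im.2 him]
    simp
  refine card_filter_eq_of_involution R (·⁻¹) hinv (fun z _ => inv_inv z) ?_ ?_
  · rintro z hz ⟨him, h1⟩
    refine ⟨(im_inv_eq_zero_iff (h0 z hz)).2 him, (one_lt_norm_inv_iff (h0 z hz)).2 ?_⟩
    exact lt_of_le_of_ne (not_lt.1 h1) (this z hz him)
  · rintro z hz ⟨him, h1⟩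
    exact ⟨(im_inv_eq_zero_iff (h0 z hz)).2 him,
      not_lt.2 ((norm_inv_lt_one_iff (h0 z hz)).2 h1).le⟩

open Classical in
lemma card_generic_eq (h0 : ∀ z ∈ R, z ≠ 0) (hinv : ∀ z ∈ R, z⁻¹ ∈ R)
    (hconj : ∀ z ∈ R, (starRingEnd ℂ) z ∈ R) :
    (R.filter fun z => z.im ≠ 0 ∧ ‖z‖ ≠ 1).card =
      4 * (R.filter fun z => 0 < z.im ∧ 1 < ‖z‖).card := by
  have h1 : (R.filter fun z => z.im ≠ 0 ∧ ‖z‖ ≠ 1).card =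
      2 * (R.filter fun z => z.im ≠ 0 ∧ 1 < ‖z‖).card := by
    rw [← Finset.card_filter_add_card_filter_not (s := R.filter fun z => z.im ≠ 0 ∧ ‖z‖ ≠ 1)
      (fun z => 1 < ‖z‖), Finset.filter_filter, Finset.filter_filter, two_mul]
    congr 1
    · congr 1
      refine Finset.filter_congr fun z _ => ?_
      exact ⟨fun h => ⟨h.1.1, h.2⟩, fun h => ⟨⟨h.1, h.2.ne'⟩, h.2⟩⟩
    · refine card_filter_eq_of_involution R (·⁻¹) hinv (fun z _ => inv_inv z) ?_ ?_
      · rintro z hz ⟨⟨him, hz1⟩, hlt⟩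
        exact ⟨mt (im_inv_eq_zero_iff (h0 z hz)).1 him,
          (one_lt_norm_inv_iff (h0 z hz)).2 (lt_of_le_of_ne (not_lt.1 hlt) hz1)⟩
      · rintro z hz ⟨him, hlt⟩
        have := (norm_inv_lt_one_iff (h0 z hz)).2 hlt
        exact ⟨⟨mt (im_inv_eq_zero_iff (h0 z hz)).1 him, this.ne⟩, not_lt.2 this.le⟩
  have h2 : (R.filter fun z => z.im ≠ 0 ∧ 1 < ‖z‖).card =
      2 * (R.filter fun z => 0 < z.im ∧ 1 < ‖z‖).card := by
    rw [← Finset.card_filter_add_card_filter_not (s := R.filter fun z => z.im ≠ 0 ∧ 1 < ‖z‖)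
      (fun z => 0 < z.im), Finset.filter_filter, Finset.filter_filter, two_mul]
    congr 1
    · congr 1
      refine Finset.filter_congr fun z _ => ?_
      exact ⟨fun h => ⟨h.2, h.1.2⟩, fun h => ⟨⟨h.1.ne', h.2⟩, h.1⟩⟩
    · refine card_filter_eq_of_involution R (starRingEnd ℂ) hconj
        (fun z _ => Complex.conj_conj z) ?_ ?_
      · rintro z hz ⟨⟨him, hz1⟩, hlt⟩
        refine ⟨?_, by simpa using hz1⟩
        rw [Complex.conj_im]
        exact neg_pos.2 (lt_of_le_of_ne (not_lt.1 hlt) him)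
      · rintro z hz ⟨him, hlt⟩
        refine ⟨⟨?_, by simpa using hlt⟩, ?_⟩
        · rw [Complex.conj_im]; exact neg_ne_zero.2 him.ne'
        · rw [Complex.conj_im]; exact not_lt.2 (neg_nonpos.2 him.le)
  rw [h1, h2]; ring

open Classical in
lemma card_outer_eq :
    (R.filter fun z => 1 < ‖z‖ ∧ 0 ≤ z.im).card =
      (R.filter fun z => z.im = 0 ∧ 1 < ‖z‖).card +
        (R.filter fun z => 0 < z.im ∧ 1 < ‖z‖).card := by
  rw [← Finset.card_filter_add_card_filter_not (s := R.filter fun z => 1 < ‖z‖ ∧ 0 ≤ z.im)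
      (fun z => z.im = 0), Finset.filter_filter, Finset.filter_filter]
  congr 2
  · refine Finset.filter_congr fun z _ => ?_
    exact ⟨fun h => ⟨h.2, h.1.1⟩, fun h => ⟨⟨h.2, h.1.ge⟩, h.1⟩⟩
  · refine Finset.filter_congr fun z _ => ?_
    exact ⟨fun h => ⟨lt_of_le_of_ne h.1.2 (Ne.symm h.2), h.1.1⟩,
      fun h => ⟨⟨h.2, h.1.le⟩, h.1.ne'⟩⟩

end EigenvalueCounts

section MatrixCounts

variable {ι : Type*} [Fintype ι] [DecidableEq ι]

lemma charpoly_map_complex (A : Matrix ι ι ℤ) :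
    (A.map (Int.cast : ℤ → ℂ)).charpoly = (ratMatrix A).charpoly.map (algebraMap ℚ ℂ) := by
  rw [← Matrix.charpoly_map]
  congr 1

lemma card_roots_filter {A : Matrix ι ι ℤ} (hA : (ratMatrix A).charpoly.Separable)
    (P : ℂ → Prop) [DecidablePred P] :
    ((A.map (Int.cast : ℤ → ℂ)).charpoly.roots.filter P).card =
      (((ratMatrix A).charpoly.rootSet ℂ).toFinset.filter P).card := by
  have hnd : ((ratMatrix A).charpoly.aroots ℂ).Nodup := nodup_roots hA.map
  have : (((ratMatrix A).charpoly.rootSet ℂ).toFinset).val = (ratMatrix A).charpoly.aroots ℂ := by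
    rw [← hnd.dedup, ← Multiset.toFinset_val]
    congr 1
    ext z
    simp [rootSet_def]
  rw [charpoly_map_complex, Finset.card_def, Finset.filter_val, this]

open Classical in
lemma ncard_outerEigenvalues (M : Matrix ι ι ℚ) :
    (outerEigenvalues M).ncard =
      ((M.charpoly.rootSet ℂ).toFinset.filter fun z => 1 < ‖z‖ ∧ 0 ≤ z.im).card := by
  rw [← Set.ncard_image_of_injective _ Subtype.val_injective, ← Set.ncard_coe_finset]
  congr 1
  ext z
  simp only [outerEigenvalues, Set.mem_image, Set.mem_ofPred_eq, Finset.coe_filter,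
    Set.mem_toFinset]
  exact ⟨fun ⟨w, hw, h⟩ => h ▸ ⟨w.2, hw⟩, fun h => ⟨⟨z, h.1⟩, h.2, rfl⟩⟩

end MatrixCounts

/-! ### The centralizer -/

section UnitVectors

lemma ratMatrix_mul {ι : Type*} [Fintype ι] (A B : Matrix ι ι ℤ) :
    ratMatrix (A * B) = ratMatrix A * ratMatrix B :=
  Matrix.map_mul (f := Int.castRingHom ℚ)

lemma ratMatrix_injective {ι : Type*} :
    Function.Injective (ratMatrix : Matrix ι ι ℤ → Matrix ι ι ℚ) :=
  Matrix.map_injective Int.cast_injective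

variable {ι : Type*} [Fintype ι] [DecidableEq ι]

lemma ratMatrix_one : ratMatrix (1 : Matrix ι ι ℤ) = 1 :=
  map_one (Int.castRingHom ℚ).mapMatrix

lemma ratMatrix_symplecticAdjoint {l : Type*} [Fintype l] [DecidableEq l]
    (B : Matrix (l ⊕ l) (l ⊕ l) ℤ) :
    ratMatrix (symplecticAdjoint B) = symplecticAdjoint (ratMatrix B) :=
  map_symplecticAdjoint (Int.castRingHom ℚ) B

lemma ratMatrix_mem_symplecticGroup_iff {l : Type*} [Fintype l] [DecidableEq l]
    {B : Matrix (l ⊕ l) (l ⊕ l) ℤ} :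
    ratMatrix B ∈ Matrix.symplecticGroup l ℚ ↔ B ∈ Matrix.symplecticGroup l ℤ := by
  rw [← mul_symplecticAdjoint_eq_one_iff, ← mul_symplecticAdjoint_eq_one_iff,
    ← ratMatrix_symplecticAdjoint, ← ratMatrix_mul, ← ratMatrix_one]
  exact ratMatrix_injective.eq_iff

/-- The element of the field of an irreducible factor given by a polynomial `g` with `g(M)`
an integer matrix is an algebraic integer. -/
lemma isIntegral_mk_of_integerMatrix {M : Matrix ι ι ℚ} {p g : ℚ[X]} (hp : p ∈ factors M)
    (hg : aeval M g ∈ integerMatrices ι) : IsIntegral ℤ (AdjoinRoot.mk p g) := by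
  obtain ⟨B, hB⟩ := mem_integerMatrices.1 hg
  refine ⟨B.charpoly, B.charpoly_monic, ?_⟩
  rw [← aeval_def, ← aeval_map_algebraMap ℚ, ← AdjoinRoot.aeval_eq, ← aeval_comp,
    AdjoinRoot.aeval_eq, AdjoinRoot.mk_eq_zero]
  obtain ⟨z, hz, hzp⟩ := exists_root_of_factor hp
  refine dvd_of_factor hp hzp (aeval_root_eq_zero (M := M) ?_ hz)
  have h : B.charpoly.map (algebraMap ℤ ℚ) = (ratMatrix B).charpoly :=
    (Matrix.charpoly_map B (Int.castRingHom ℚ)).symm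
  rw [aeval_comp, h, ← hB, Matrix.aeval_self_charpoly]

/-- The product formula: the norm of a unit is `±1`. -/
lemma classSum_logVector {M : Matrix ι ι ℚ} {p g : ℚ[X]} (hp : p ∈ factors M)
    (hg : IsIntegerUnit M g) : classSum M p (logVector M g) = 0 := by
  have : Fact (Irreducible p) := ⟨irreducible_of_mem_factors hp⟩
  obtain ⟨hg, g', hgg', hg'⟩ := hg
  let a : NumberField.RingOfIntegers (AdjoinRoot p) := ⟨_, isIntegral_mk_of_integerMatrix hp hg⟩
  let b : NumberField.RingOfIntegers (AdjoinRoot p) := ⟨_, isIntegral_mk_of_integerMatrix hp hg'⟩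
  have hab : a * b = 1 := by
    apply NumberField.RingOfIntegers.ext
    change AdjoinRoot.mk p g * AdjoinRoot.mk p g' = 1
    obtain ⟨z, hz, hzp⟩ := exists_root_of_factor hp
    rw [← map_mul, ← map_one (AdjoinRoot.mk p), ← sub_eq_zero, ← map_sub, AdjoinRoot.mk_eq_zero]
    refine dvd_of_factor hp hzp (aeval_root_eq_zero (M := M) ?_ hz)
    rw [map_sub, hgg', map_one, sub_self]
  let u : (NumberField.RingOfIntegers (AdjoinRoot p))ˣ := ⟨a, b, hab, (mul_comm _ _).trans hab⟩
  have hu : (u : AdjoinRoot p) = AdjoinRoot.mk p g := rfl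
  rw [classSum_apply, ← sum_embeddingRoot hp, ← NumberField.Units.sum_mult_mul_log u]
  have h1 : ∀ φ : AdjoinRoot p →+* ℂ,
      logVector M g (embeddingRoot hp φ) = Real.log ‖φ (u : AdjoinRoot p)‖ := by
    intro φ
    rw [logVector, aeval_embeddingRoot, hu]
  rw [Finset.sum_congr rfl fun φ _ => h1 φ, sum_embeddings_eq_sum_places
    (x := fun φ => Real.log ‖φ (u : AdjoinRoot p)‖)
    (fun φ => by rw [NumberField.ComplexEmbedding.conjugate_coe_eq, RCLike.norm_conj])]
  refine Finset.sum_congr rfl fun w _ => ?_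
  rw [NumberField.InfinitePlace.norm_embedding_eq]

lemma logVector_conj (M : Matrix ι ι ℚ) (g : ℚ[X]) {z w : M.charpoly.rootSet ℂ}
    (h : (w : ℂ) = (starRingEnd ℂ) z) : logVector M g w = logVector M g z := by
  have := aeval_algHom_apply (Complex.conjAe.toAlgHom.restrictScalars ℚ) (z : ℂ) g
  have h2 : aeval ((starRingEnd ℂ) (z : ℂ)) g = (starRingEnd ℂ) (aeval (z : ℂ) g) := this
  rw [logVector, logVector, h, h2, RCLike.norm_conj]

/-- Only finitely many integer matrices `g(M)` have eigenvalues in a given bounded set, since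
the entries of `g(M)` are fixed linear combinations of its eigenvalues. -/
lemma finite_integerMatrices_of_bounded {M : Matrix ι ι ℚ} (hM : M.charpoly.Separable) (r : ℝ) :
    {B : Matrix ι ι ℤ | ∃ g : ℚ[X], ratMatrix B = aeval M g ∧
      ∀ z ∈ M.charpoly.rootSet ℂ, ‖aeval z g‖ ≤ r}.Finite := by
  classical
  let s := (M.charpoly.rootSet ℂ).toFinset
  let Z : ℂ → Matrix ι ι ℂ := fun z => aeval (M.map (algebraMap ℚ ℂ)) (Lagrange.basis s id z)
  let K : ι → ι → ℤ := fun i j => ⌈∑ z ∈ s, r * ‖Z z i j‖⌉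
  have hfin : {B : Matrix ι ι ℤ |
      ∀ i, B i ∈ {f : ι → ℤ | ∀ j, f j ∈ Set.Icc (-K i j) (K i j)}}.Finite :=
    Set.Finite.pi' fun i => Set.Finite.pi' fun j => Set.finite_Icc _ _
  refine hfin.subset ?_
  rintro B ⟨g, hB, hg⟩ i j
  have hinterp : aeval (M.map (algebraMap ℚ ℂ)) (g.map (algebraMap ℚ ℂ)) =
      ∑ z ∈ s, aeval z g • Z z := by
    have h := aeval_map_eq_zero_of_roots hM (h := g.map (algebraMap ℚ ℂ) -
      Lagrange.interpolate s id (fun z => aeval z g)) (fun z hz => by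
        have h1 : eval z (Lagrange.interpolate s id fun z => aeval z g) = aeval z g :=
          Lagrange.eval_interpolate_at_node (v := id) _ (Set.injOn_id _) (Set.mem_toFinset.2 hz)
        rw [eval_sub, h1, eval_map_algebraMap, sub_self])
    rw [map_sub, sub_eq_zero] at h
    rw [h, Lagrange.interpolate_apply, map_sum]
    refine Finset.sum_congr rfl fun z _ => ?_
    rw [map_mul, aeval_C, ← Algebra.smul_def]
  rw [aeval_map_matrix, ← hB] at hinterp
  have hentry : (B i j : ℂ) = ∑ z ∈ s, aeval z g * Z z i j := by
    have := congrFun (congrFun hinterp i) j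
    rw [Matrix.sum_apply] at this
    simpa using this
  have hbound : |(B i j : ℝ)| ≤ ∑ z ∈ s, r * ‖Z z i j‖ := by
    have h1 : |(B i j : ℝ)| = ‖(B i j : ℂ)‖ := by simp
    rw [h1, hentry]
    refine (norm_sum_le _ _).trans (Finset.sum_le_sum fun z hz => ?_)
    rw [norm_mul]
    exact mul_le_mul_of_nonneg_right (hg z (Set.mem_toFinset.1 hz)) (norm_nonneg _)
  have h2 : |B i j| ≤ K i j := by
    have : ((|B i j| : ℤ) : ℝ) ≤ (K i j : ℝ) := by
      push_cast
      exact hbound.trans (Int.le_ceil _)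
    exact_mod_cast this
  exact abs_le.1 h2

end UnitVectors

section Centralizer

variable {d : ℕ} {A : Matrix.symplecticGroup (Fin d) ℤ}

lemma ratMatrix_mem (A : Matrix.symplecticGroup (Fin d) ℤ) :
    ratMatrix (A : Matrix (Fin d ⊕ Fin d) (Fin d ⊕ Fin d) ℤ) ∈ Matrix.symplecticGroup (Fin d) ℚ :=
  ratMatrix_mem_symplecticGroup_iff.2 A.2

lemma exists_polynomial_of_mem_centralizer (hA : (ratMatrix A.1).charpoly.Separable)
    (B : Subgroup.centralizer {A}) : ∃ g : ℚ[X], ratMatrix B.1.1 = aeval (ratMatrix A.1) g := by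
  refine exists_polynomial_of_commute hA ?_
  have h : A * B.1 = B.1 * A := Subgroup.mem_centralizer_iff.1 B.2 A rfl
  have h2 : A.1 * B.1.1 = B.1.1 * A.1 := congrArg Subtype.val h
  rw [commute_iff_eq, ← ratMatrix_mul, ← ratMatrix_mul, h2]

/-- A polynomial that represents an element of the centralizer. -/
noncomputable def reprPoly (hA : (ratMatrix A.1).charpoly.Separable)
    (B : Subgroup.centralizer {A}) : ℚ[X] :=
  (exists_polynomial_of_mem_centralizer hA B).choose

lemma aeval_reprPoly (hA : (ratMatrix A.1).charpoly.Separable) (B : Subgroup.centralizer {A}) :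
    aeval (ratMatrix A.1) (reprPoly hA B) = ratMatrix B.1.1 :=
  (exists_polynomial_of_mem_centralizer hA B).choose_spec.symm

lemma centralizer_mul_comm (hA : (ratMatrix A.1).charpoly.Separable)
    (B C : Subgroup.centralizer {A}) : B * C = C * B := by
  apply Subtype.ext
  apply Subtype.ext
  apply ratMatrix_injective
  change ratMatrix (B.1.1 * C.1.1) = ratMatrix (C.1.1 * B.1.1)
  rw [ratMatrix_mul, ratMatrix_mul, ← aeval_reprPoly hA, ← aeval_reprPoly hA, ← map_mul,
    ← map_mul, mul_comm]

/-- On an element of the centralizer the involution `A ↦ A⁻¹` is inversion. -/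
lemma aeval_mul_aeval_inv_eq_one (hA : (ratMatrix A.1).charpoly.Separable) {g : ℚ[X]}
    {B : Matrix.symplecticGroup (Fin d) ℤ} (hB : aeval (ratMatrix A.1) g = ratMatrix B.1)
    {z : ℂ} (hz : z ∈ (ratMatrix A.1).charpoly.rootSet ℂ) :
    aeval z g * aeval z⁻¹ g = 1 := by
  have h1 := mul_symplecticAdjoint_eq_one_iff.2 (ratMatrix_mem B)
  rw [← hB, ← aeval_comp_adjointPoly hA (ratMatrix_mem A), ← map_mul,
    ← map_one (aeval (R := ℚ) (ratMatrix A.1)), aeval_eq_iff hA] at h1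
  have := h1 z hz
  rwa [map_mul, aeval_root_comp_adjointPoly hA _ _ hz, map_one] at this

lemma isIntegerUnit_of_symplectic (hA : (ratMatrix A.1).charpoly.Separable) {g : ℚ[X]}
    {B : Matrix.symplecticGroup (Fin d) ℤ} (hB : aeval (ratMatrix A.1) g = ratMatrix B.1) :
    IsIntegerUnit (ratMatrix A.1) g := by
  refine ⟨hB ▸ mem_integerMatrices.2 ⟨_, rfl⟩, g.comp (adjointPoly hA (ratMatrix_mem A)), ?_, ?_⟩
  · rw [map_mul, aeval_comp_adjointPoly, hB, mul_symplecticAdjoint_eq_one_iff]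
    exact ratMatrix_mem B
  · rw [aeval_comp_adjointPoly, hB, ← ratMatrix_symplecticAdjoint]
    exact mem_integerMatrices.2 ⟨_, rfl⟩

lemma logVector_mem_unitLogSpace (hA : (ratMatrix A.1).charpoly.Separable) {g : ℚ[X]}
    {B : Matrix.symplecticGroup (Fin d) ℤ} (hB : aeval (ratMatrix A.1) g = ratMatrix B.1) :
    logVector (ratMatrix A.1) g ∈ unitLogSpace (ratMatrix A.1) := by
  refine mem_unitLogSpace.2 ⟨⟨fun z w h => logVector_conj _ _ h, fun z w h => ?_⟩, fun p hp =>
    classSum_logVector hp (isIntegerUnit_of_symplectic hA hB)⟩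
  have h1 := aeval_mul_aeval_inv_eq_one hA hB z.2
  rw [logVector, logVector, h, ← Real.log_inv, ← norm_inv]
  congr 2
  exact eq_inv_of_mul_eq_one_right h1

/-- The logarithmic embedding of the centralizer. -/
noncomputable def logMap (hA : (ratMatrix A.1).charpoly.Separable) :
    Additive (Subgroup.centralizer {A}) →+ unitLogSpace (ratMatrix A.1) :=
  AddMonoidHom.mk' (fun B => ⟨logVector (ratMatrix A.1) (reprPoly hA B.toMul),
    logVector_mem_unitLogSpace hA (aeval_reprPoly hA B.toMul)⟩) (by
    intro B C
    apply Subtype.ext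
    funext z
    have h : aeval (ratMatrix A.1) (reprPoly hA (B + C).toMul) =
        aeval (ratMatrix A.1) (reprPoly hA B.toMul * reprPoly hA C.toMul) := by
      rw [map_mul, aeval_reprPoly, aeval_reprPoly, aeval_reprPoly, ← ratMatrix_mul]
      rfl
    have h1 := aeval_mul_aeval_inv_eq_one hA (aeval_reprPoly hA B.toMul) z.2
    have h2 := aeval_mul_aeval_inv_eq_one hA (aeval_reprPoly hA C.toMul) z.2
    change Real.log ‖_‖ = Real.log ‖_‖ + Real.log ‖_‖
    rw [(aeval_eq_iff hA).1 h z z.2, map_mul, norm_mul, Real.log_mul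
      (norm_ne_zero_iff.2 (left_ne_zero_of_mul_eq_one h1))
      (norm_ne_zero_iff.2 (left_ne_zero_of_mul_eq_one h2))])

lemma logMap_apply (hA : (ratMatrix A.1).charpoly.Separable) (B : Subgroup.centralizer {A})
    (z : (ratMatrix A.1).charpoly.rootSet ℂ) :
    (logMap hA (Additive.ofMul B)).1 z = Real.log ‖aeval (z : ℂ) (reprPoly hA B)‖ := rfl

lemma finite_logMap_le (hA : (ratMatrix A.1).charpoly.Separable) (r : ℝ) :
    {B : Subgroup.centralizer {A} | ‖logMap hA (Additive.ofMul B)‖ ≤ r}.Finite := by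
  refine Set.Finite.of_finite_image (f := fun B : Subgroup.centralizer {A} => B.1.1) ?_
    (fun B _ C _ h => Subtype.ext (Subtype.ext h))
  refine (finite_integerMatrices_of_bounded hA (Real.exp r)).subset ?_
  rintro _ ⟨B, hB, rfl⟩
  refine ⟨reprPoly hA B, (aeval_reprPoly hA B).symm, fun z hz => ?_⟩
  have h1 := aeval_mul_aeval_inv_eq_one hA (aeval_reprPoly hA B) hz
  rw [← Real.log_le_iff_le_exp (norm_pos_iff.2 (left_ne_zero_of_mul_eq_one h1))]
  have h2 : ‖(logMap hA (Additive.ofMul B)).1 ⟨z, hz⟩‖ ≤ r := (norm_le_pi_norm _ _).trans hB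
  exact (le_abs_self _).trans h2

/-- For a unit `u` of the order `ℚ[A] ∩ M(ℤ)`, the quotient of `u` by its adjoint lies in the
centralizer. -/
lemma exists_centralizer_quotient (hA : (ratMatrix A.1).charpoly.Separable) {g : ℚ[X]}
    (hg : IsIntegerUnit (ratMatrix A.1) g) :
    ∃ B : Subgroup.centralizer {A}, ∀ z : (ratMatrix A.1).charpoly.rootSet ℂ,
      (logMap hA (Additive.ofMul B)).1 z =
        Real.log ‖aeval (z : ℂ) g‖ - Real.log ‖aeval (z : ℂ)⁻¹ g‖ := by
  have hS := ratMatrix_mem A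
  obtain ⟨⟨X, hX⟩, g', hgg', ⟨X', hX'⟩⟩ := hg
  have hval : ∀ z ∈ (ratMatrix A.1).charpoly.rootSet ℂ, aeval z g * aeval z g' = 1 := by
    intro z hz
    rw [← map_one (aeval (R := ℚ) (ratMatrix A.1)), aeval_eq_iff hA] at hgg'
    simpa using hgg' z hz
  let Y := X * symplecticAdjoint X'
  let h := g * g'.comp (adjointPoly hA hS)
  have hY : ratMatrix Y = aeval (ratMatrix A.1) h := by
    rw [map_mul, aeval_comp_adjointPoly, ratMatrix_mul, ratMatrix_symplecticAdjoint, ← hX, ← hX']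
    rfl
  have hz' : ∀ z ∈ (ratMatrix A.1).charpoly.rootSet ℂ, aeval z h = aeval z g * aeval z⁻¹ g' := by
    intro z hz
    rw [map_mul, aeval_root_comp_adjointPoly hA hS _ hz]
  have hYS : Y ∈ Matrix.symplecticGroup (Fin d) ℤ := by
    rw [← ratMatrix_mem_symplecticGroup_iff, ← mul_symplecticAdjoint_eq_one_iff, hY,
      ← aeval_comp_adjointPoly hA hS, ← map_mul, ← map_one (aeval (R := ℚ) (ratMatrix A.1)),
      aeval_eq_iff hA]
    intro z hz
    have hzi := inv_mem_rootSet hA hS hz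
    rw [map_mul, aeval_root_comp_adjointPoly hA hS _ hz, hz' z hz, hz' _ hzi, inv_inv, map_one]
    linear_combination (aeval z⁻¹ g * aeval z⁻¹ g') * hval z hz + hval _ hzi
  have hcomm : A * (⟨Y, hYS⟩ : Matrix.symplecticGroup (Fin d) ℤ) = ⟨Y, hYS⟩ * A := by
    apply Subtype.ext
    apply ratMatrix_injective
    change ratMatrix (A.1 * Y) = ratMatrix (Y * A.1)
    rw [ratMatrix_mul A.1 Y, ratMatrix_mul Y A.1, hY]
    nth_rewrite 1 [← aeval_X (R := ℚ) (ratMatrix A.1)]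
    nth_rewrite 4 [← aeval_X (R := ℚ) (ratMatrix A.1)]
    rw [← map_mul, ← map_mul, mul_comm]
  let B : Subgroup.centralizer {A} :=
    ⟨⟨Y, hYS⟩, Subgroup.mem_centralizer_iff.2 (by rintro _ rfl; exact hcomm)⟩
  refine ⟨B, fun z => ?_⟩
  have h1 : aeval (z : ℂ) (reprPoly hA B) = aeval (z : ℂ) h :=
    (aeval_eq_iff hA).1 ((aeval_reprPoly hA B).trans hY) z z.2
  have hzi := hval _ (inv_mem_rootSet hA hS z.2)
  rw [logMap_apply, h1, hz' z z.2, eq_inv_of_mul_eq_one_right hzi, norm_mul, norm_inv,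
    Real.log_mul (norm_ne_zero_iff.2 (left_ne_zero_of_mul_eq_one (hval z z.2)))
    (inv_ne_zero (norm_ne_zero_iff.2 (left_ne_zero_of_mul_eq_one hzi))), Real.log_inv,
    sub_eq_add_neg]

/-- The logarithms of the centralizer span: by Dirichlet's theorem a vector `x` of the log space
is a combination of logarithms of units `u`, and then `x = (x - x ∘ inv) / 2` is a combination of
those of the quotients of `u` by its adjoint. -/
lemma span_range_logMap (hA : (ratMatrix A.1).charpoly.Separable) :
    Submodule.span ℝ (Set.range (logMap hA)) = ⊤ := by
  have hS := ratMatrix_mem A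
  rw [eq_top_iff]
  rintro x -
  obtain ⟨⟨hconj, hanti⟩, hsum⟩ := mem_unitLogSpace.1 x.2
  have hx := mem_span_logVector hA hconj hsum
  let T : ((ratMatrix A.1).charpoly.rootSet ℂ → ℝ) →ₗ[ℝ]
      ((ratMatrix A.1).charpoly.rootSet ℂ → ℝ) :=
    (1 / 2 : ℝ) • (LinearMap.id - LinearMap.funLeft ℝ ℝ
      (fun z => ⟨(z : ℂ)⁻¹, inv_mem_rootSet hA hS z.2⟩))
  have hT : ∀ y z, T y z = 1 / 2 * (y z - y ⟨(z : ℂ)⁻¹, inv_mem_rootSet hA hS z.2⟩) :=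
    fun y z => rfl
  have hTx : T x.1 = x.1 := by
    funext z
    rw [hT, hanti z ⟨(z : ℂ)⁻¹, inv_mem_rootSet hA hS z.2⟩ rfl]
    ring
  have h2 := Submodule.mem_map_of_mem (f := T) hx
  rw [Submodule.map_span] at h2
  have h3 : T x.1 ∈ (Submodule.span ℝ (Set.range (logMap hA))).map
      (unitLogSpace (ratMatrix A.1)).subtype := by
    refine Submodule.span_le.2 ?_ h2
    rintro _ ⟨_, ⟨g, hg, rfl⟩, rfl⟩
    obtain ⟨B, hB⟩ := exists_centralizer_quotient hA hg
    refine ⟨(1 / 2 : ℝ) • logMap hA (Additive.ofMul B),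
      Submodule.smul_mem _ _ (Submodule.subset_span ⟨_, rfl⟩), ?_⟩
    funext z
    rw [hT]
    exact congrArg (1 / 2 * ·) (hB z)
  rw [hTx] at h3
  obtain ⟨y, hy, hyx⟩ := h3
  rwa [← Subtype.ext hyx]

/-- The irreducible isotropic invariant subspaces correspond to the irreducible factors of the
characteristic polynomial that differ from their dual. -/
lemma irreducibleIsotropicSubspaces_eq_image (hA : (ratMatrix A.1).charpoly.Separable) :
    irreducibleIsotropicSubspaces A.1 =
      primarySubspace (ratMatrix A.1) '' (nonSelfDualFactors (ratMatrix A.1)) := by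
  classical
  have hS := ratMatrix_mem A
  have hiso : ∀ p ∈ factors (ratMatrix A.1),
      (IsIsotropic (primarySubspace (ratMatrix A.1) p) ↔ dualFactor (ratMatrix A.1) p ≠ p) := by
    intro p hp
    obtain ⟨z, hz, rfl⟩ := mem_factors.1 hp
    rw [dualFactor_minpoly hA hS hz, Ne, minpoly_eq_iff hp]
    exact ⟨fun h h0 => not_isIsotropic_of_root_inv hA hS hp hz (minpoly.aeval _ _) h0 h,
      fun h => isIsotropic_of_root_inv hA hS hp hz (minpoly.aeval _ _) h⟩
  ext W
  constructor
  · rintro ⟨hirr, hW⟩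
    obtain ⟨p, hp, rfl⟩ := hirr.exists_factor hA
    exact ⟨p, Finset.mem_filter.2 ⟨hp, (hiso p hp).1 hW⟩, rfl⟩
  · rintro ⟨p, hp, rfl⟩
    obtain ⟨hpF, hpd⟩ := Finset.mem_filter.1 hp
    exact ⟨isIrreducibleInvariant_primarySubspace hA hpF, (hiso p hpF).2 hpd⟩

end Centralizer

end SymplecticCentralizer

theorem theorem3 (d : ℕ) (A : Matrix.symplecticGroup (Fin d) ℤ)
    (hA : ((A : Matrix (Fin d ⊕ Fin d) (Fin d ⊕ Fin d) ℤ).map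
      (Int.cast : ℤ → ℚ)).charpoly.Separable) :
    ∃ m l I : ℕ,
      SymplecticCentralizer.numRealEigenvalues
        (A : Matrix (Fin d ⊕ Fin d) (Fin d ⊕ Fin d) ℤ) = 2 * m ∧
      SymplecticCentralizer.numGenericEigenvalues
        (A : Matrix (Fin d ⊕ Fin d) (Fin d ⊕ Fin d) ℤ) = 4 * l ∧
      (SymplecticCentralizer.irreducibleIsotropicSubspaces
        (A : Matrix (Fin d ⊕ Fin d) (Fin d ⊕ Fin d) ℤ)).Finite ∧
      (SymplecticCentralizer.irreducibleIsotropicSubspaces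
        (A : Matrix (Fin d ⊕ Fin d) (Fin d ⊕ Fin d) ℤ)).ncard = 2 * I ∧
      I ≤ m + l ∧
      ∃ F : Subgroup (Matrix.symplecticGroup (Fin d) ℤ),
        F ≤ Subgroup.centralizer {A} ∧
        Finite F ∧
        (∀ B ∈ F, ∀ C ∈ F, B * C = C * B) ∧
        (∀ B ∈ F, B ^ Nat.card F = 1) ∧
        Nonempty (Subgroup.centralizer {A} ≃* F × Multiplicative (Fin (m + l - I) → ℤ)) := by
  open SymplecticCentralizer in
  classical
  have hS := ratMatrix_mem A
  let R : Finset ℂ := ((ratMatrix A.1).charpoly.rootSet ℂ).toFinset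
  have h0 : ∀ z ∈ R, z ≠ 0 := fun z hz => root_ne_zero hA hS (Set.mem_toFinset.1 hz)
  have hinv : ∀ z ∈ R, z⁻¹ ∈ R := fun z hz =>
    Set.mem_toFinset.2 (inv_mem_rootSet hA hS (Set.mem_toFinset.1 hz))
  have hne : ∀ z ∈ R, z⁻¹ ≠ z := fun z hz => inv_ne_self_of_root hA hS (Set.mem_toFinset.1 hz)
  have hconj : ∀ z ∈ R, (starRingEnd ℂ) z ∈ R := fun z hz =>
    Set.mem_toFinset.2 (conj_mem_rootSet (Set.mem_toFinset.1 hz))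
  obtain ⟨I, hI, hrank⟩ := exists_finrank_unitLogSpace hA hS
  rw [ncard_outerEigenvalues, card_outer_eq] at hrank
  have himage := irreducibleIsotropicSubspaces_eq_image hA
  refine ⟨(R.filter fun z => z.im = 0 ∧ 1 < ‖z‖).card, (R.filter fun z => 0 < z.im ∧ 1 < ‖z‖).card,
    I, ?_, ?_, ?_, ?_, ?_, ?_⟩
  · rw [numRealEigenvalues, card_roots_filter hA]
    exact card_real_eq h0 hinv hne
  · rw [numGenericEigenvalues, card_roots_filter hA]
    exact card_generic_eq h0 hinv hconj
  · rw [himage]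
    exact (Finset.finite_toSet _).image _
  · have hinj : Set.InjOn (primarySubspace (ratMatrix A.1)) (nonSelfDualFactors (ratMatrix A.1)) :=
      (primarySubspace_injOn hA).mono (Finset.coe_subset.2 (Finset.filter_subset _ _))
    rw [himage, hinj.ncard_image, Set.ncard_coe_finset, hI]
  · exact hrank ▸ Nat.le_add_left _ _
  · let : CommGroup (Subgroup.centralizer {A}) :=
      { (inferInstance : Group (Subgroup.centralizer {A})) with
        mul_comm := centralizer_mul_comm hA }
    obtain ⟨N, hN, ⟨e⟩⟩ := exists_mulEquiv_of_log (logMap hA) (finite_logMap_le hA)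
      (span_range_logMap hA)
    have hdim : Module.finrank ℝ (unitLogSpace (ratMatrix A.1)) =
        (R.filter fun z => z.im = 0 ∧ 1 < ‖z‖).card +
          (R.filter fun z => 0 < z.im ∧ 1 < ‖z‖).card - I := by
      rw [← hrank, Nat.add_sub_cancel]
    rw [hdim] at e
    let eN := N.equivMapOfInjective _ (Subgroup.centralizer {A}).subtype_injective
    have hfin : Finite (N.map (Subgroup.centralizer {A}).subtype) := Finite.of_equiv N eN.toEquiv
    refine ⟨N.map (Subgroup.centralizer {A}).subtype, ?_, hfin, ?_, ?_, ⟨e.trans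
      (eN.prodCongr (MulEquiv.refl _))⟩⟩
    · rintro _ ⟨B, -, rfl⟩
      exact B.2
    · rintro _ ⟨B, -, rfl⟩ _ ⟨C, -, rfl⟩
      exact congrArg Subtype.val (centralizer_mul_comm hA B C)
    · intro B hB
      exact congrArg Subtype.val (pow_card_eq_one' (x := (⟨B, hB⟩ :
        N.map (Subgroup.centralizer {A}).subtype)))
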